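/- Let $n\ge 2$, and for $1\le i,j\le n-1$ put $\langle i,i\rangle=1$, $\langle i+1,i\rangle=-1$, $\langle i,j\rangle=0$ in all other cases, and $i\cdot j=\langle i,j\rangle+\langle j,i\rangle$. Let $U_{v,t}(sl_n)$ be the associative unital algebra over the field $\mathbb{Q}(v,t)$ of rational functions in two indeterminates $v,t$ with generators $E_i,F_i,K_i^{\pm1},{K_i'}^{\pm1}$ $(1\le i\le n-1)$ and the following relations, for all admissible indices: (R1) all the $K_i^{\pm1}$ and ${K_j'}^{\pm1}$ commute with one another, and $K_i^{\pm1}K_i^{\mp1}=1={K_i'}^{\pm1}{K_i'}^{\mp1}$; (R2) $K_iE_jK_i^{-1}=v^{i\cdot j}t^{\langle i,j\rangle-\langle j,i\rangle}E_j$, $\quad K_i'E_j{K_i'}^{-1}=v^{-i\cdot j}t^{\langle i,j\rangle-\langle j,i\rangle}E_j$, $\quad K_iF_jK_i^{-1}=v^{-i\cdot j}t^{\langle j,i\rangle-\langle i,j\rangle}F_j$, $\quad K_i'F_j{K_i'}^{-1}=v^{i\cdot j}t^{\langle j,i\rangle-\langle i,j\rangle}F_j$; (R3) $E_iF_j-F_jE_i=\delta_{ij}\dfrac{K_i-K_i'}{v-v^{-1}}$;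 (R4) $E_iE_j=E_jE_i$ and $F_iF_j=F_jF_i$ if $|i-j|>1$; (R5) $E_i^2E_{i+1}-t(v+v^{-1})E_iE_{i+1}E_i+t^2E_{i+1}E_i^2=0$, $\quad E_iE_{i+1}^2-t(v+v^{-1})E_{i+1}E_iE_{i+1}+t^2E_{i+1}^2E_i=0$; (R6) $F_i^2F_{i+1}-t^{-1}(v+v^{-1})F_iF_{i+1}F_i+t^{-2}F_{i+1}F_i^2=0$, $\quad F_iF_{i+1}^2-t^{-1}(v+v^{-1})F_{i+1}F_iF_{i+1}+t^{-2}F_{i+1}^2F_i=0$. Let $U^-$, $U^0$ and $U^+$ be the unital subalgebras of $U_{v,t}(sl_n)$ generated, respectively, by the $F_i$, by the $K_i^{\pm1}$ and ${K_i'}^{\pm1}$, and by the $E_i$ $(1\le i\le n-1)$. Then $U_{v,t}(sl_n)$ has a triangular decomposition: multiplication $x\otimes y\otimes z\mapsto xyz$ is an isomorphism of $\mathbb{Q}(v,t)$-vector spaces $$U^-\otimes_{\mathbb{Q}(v,t)} U^0\otimes_{\mathbb{Q}(v,t)} U^+\;\xrightarrow{\ \sim\ }\;U_{v,t}(sl_n).$$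 -/

import Mathlib

open scoped TensorProduct

namespace TwoParamQuantum

/-- The (non-symmetric) form `⟨i, j⟩ = Ω i j` of type `A_{n-1}`: `1` on the diagonal, `-1` just below
the diagonal, `0` elsewhere. The indices `1, …, n-1` are represented by `Fin (n - 1)`. -/
def Ω {n : ℕ} (i j : Fin (n - 1)) : ℤ :=
  if i = j then 1 else if (i : ℕ) = (j : ℕ) + 1 then -1 else 0

/-- The symmetrized form `i · j = ⟨i, j⟩ + ⟨j, i⟩`. -/
def dot {n : ℕ} (i j : Fin (n - 1)) : ℤ := Ω i j + Ω j i

/-- The skew part `⟨i, j⟩ - ⟨j, i⟩`. -/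
def skew {n : ℕ} (i j : Fin (n - 1)) : ℤ := Ω i j - Ω j i

/-- The generators; `K i ε` and `K' i ε`, with `ε : ℤˣ` a sign, stand for
`K_i^{ε}` and `K_i'^{ε}`. -/
inductive Gen (n : ℕ) : Type
  | E (i : Fin (n - 1))
  | F (i : Fin (n - 1))
  | K (i : Fin (n - 1)) (ε : ℤˣ)
  | K' (i : Fin (n - 1)) (ε : ℤˣ)

section Algebra

variable (k : Type) [Field k] (n : ℕ)

/-- Generator `E_i` of the free algebra. -/
abbrev fE {n : ℕ} (i : Fin (n - 1)) : FreeAlgebra k (Gen n) := FreeAlgebra.ι k (Gen.E i)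

/-- Generator `F_i` of the free algebra. -/
abbrev fF {n : ℕ} (i : Fin (n - 1)) : FreeAlgebra k (Gen n) := FreeAlgebra.ι k (Gen.F i)

/-- Generator `K_i^{ε}` of the free algebra. -/
abbrev fK {n : ℕ} (i : Fin (n - 1)) (ε : ℤˣ) : FreeAlgebra k (Gen n) :=
  FreeAlgebra.ι k (Gen.K i ε)

/-- Generator `K_i'^{ε}` of the free algebra. -/
abbrev fK' {n : ℕ} (i : Fin (n - 1)) (ε : ℤˣ) : FreeAlgebra k (Gen n) :=
  FreeAlgebra.ι k (Gen.K' i ε)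

/-- The defining relations of the two-parameter quantum algebra with parameters `v`, `t` in `k`. -/
inductive Rel (v t : k) : FreeAlgebra k (Gen n) → FreeAlgebra k (Gen n) → Prop
  -- the Cartan part
  | K_comm (i j : Fin (n - 1)) (ε δ : ℤˣ) :
      Rel v t (fK k i ε * fK k j δ) (fK k j δ * fK k i ε)
  | K'_comm (i j : Fin (n - 1)) (ε δ : ℤˣ) :
      Rel v t (fK' k i ε * fK' k j δ) (fK' k j δ * fK' k i ε)
  | K_K'_comm (i j : Fin (n - 1)) (ε δ : ℤˣ) :
      Rel v t (fK k i ε * fK' k j δ) (fK' k j δ * fK k i ε)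
  | K_inv (i : Fin (n - 1)) (ε : ℤˣ) : Rel v t (fK k i ε * fK k i (-ε)) 1
  | K'_inv (i : Fin (n - 1)) (ε : ℤˣ) : Rel v t (fK' k i ε * fK' k i (-ε)) 1
  -- the action of the Cartan part on the `E_j` and `F_j`
  | K_E (i j : Fin (n - 1)) :
      Rel v t (fK k i 1 * fE k j * fK k i (-1)) ((v ^ dot i j * t ^ skew i j) • fE k j)
  | K'_E (i j : Fin (n - 1)) :
      Rel v t (fK' k i 1 * fE k j * fK' k i (-1)) ((v ^ (-dot i j) * t ^ skew i j) • fE k j)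
  | K_F (i j : Fin (n - 1)) :
      Rel v t (fK k i 1 * fF k j * fK k i (-1)) ((v ^ (-dot i j) * t ^ skew j i) • fF k j)
  | K'_F (i j : Fin (n - 1)) :
      Rel v t (fK' k i 1 * fF k j * fK' k i (-1)) ((v ^ dot i j * t ^ skew j i) • fF k j)
  -- commutators of the `E_i` and `F_j`
  | E_F_same (i : Fin (n - 1)) :
      Rel v t (fE k i * fF k i - fF k i * fE k i) ((v - v⁻¹)⁻¹ • (fK k i 1 - fK' k i 1))
  | E_F_ne (i j : Fin (n - 1)) (h : i ≠ j) :
      Rel v t (fE k i * fF k j - fF k j * fE k i) 0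
  -- `|i - j| > 1`
  | E_comm (i j : Fin (n - 1)) (h : (i : ℕ) + 1 < j ∨ (j : ℕ) + 1 < i) :
      Rel v t (fE k i * fE k j - fE k j * fE k i) 0
  | F_comm (i j : Fin (n - 1)) (h : (i : ℕ) + 1 < j ∨ (j : ℕ) + 1 < i) :
      Rel v t (fF k i * fF k j - fF k j * fF k i) 0
  -- Serre relations, `j = i + 1`
  | E_serre₁ (i j : Fin (n - 1)) (h : (j : ℕ) = (i : ℕ) + 1) :
      Rel v t (fE k i ^ 2 * fE k j - (t * (v + v⁻¹)) • (fE k i * fE k j * fE k i)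
        + t ^ 2 • (fE k j * fE k i ^ 2)) 0
  | E_serre₂ (i j : Fin (n - 1)) (h : (j : ℕ) = (i : ℕ) + 1) :
      Rel v t (fE k i * fE k j ^ 2 - (t * (v + v⁻¹)) • (fE k j * fE k i * fE k j)
        + t ^ 2 • (fE k j ^ 2 * fE k i)) 0
  | F_serre₁ (i j : Fin (n - 1)) (h : (j : ℕ) = (i : ℕ) + 1) :
      Rel v t (fF k i ^ 2 * fF k j - (t⁻¹ * (v + v⁻¹)) • (fF k i * fF k j * fF k i)
        + (t⁻¹) ^ 2 • (fF k j * fF k i ^ 2)) 0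
  | F_serre₂ (i j : Fin (n - 1)) (h : (j : ℕ) = (i : ℕ) + 1) :
      Rel v t (fF k i * fF k j ^ 2 - (t⁻¹ * (v + v⁻¹)) • (fF k j * fF k i * fF k j)
        + (t⁻¹) ^ 2 • (fF k j ^ 2 * fF k i)) 0

variable (v t : k)

/-- The `k`-algebra presented by the generators `Gen n` and the relations `Rel`. -/
abbrev U : Type := RingQuot (Rel k n v t)

/-- The image in `U` of a generator. -/
def gen (g : Gen n) : U k n v t := RingQuot.mkAlgHom k (Rel k n v t) (FreeAlgebra.ι k g)

/-- The subalgebra `U⁺` generated by the `E_i`. -/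
def Upos : Subalgebra k (U k n v t) :=
  Algebra.adjoin k (Set.range fun i : Fin (n - 1) => gen k n v t (Gen.E i))

/-- The subalgebra `U⁻` generated by the `F_i`. -/
def Uneg : Subalgebra k (U k n v t) :=
  Algebra.adjoin k (Set.range fun i : Fin (n - 1) => gen k n v t (Gen.F i))

/-- The subalgebra `U⁰` generated by the `K_i^{±1}` and `K_i'^{±1}`. -/
def Uzero : Subalgebra k (U k n v t) :=
  Algebra.adjoin k
    ((Set.range fun p : Fin (n - 1) × ℤˣ => gen k n v t (Gen.K p.1 p.2)) ∪
      Set.range fun p : Fin (n - 1) × ℤˣ => gen k n v t (Gen.K' p.1 p.2))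

end Algebra

/-- The field `ℚ(v, t)` of rational functions in two indeterminates. -/
abbrev Qvt : Type := FractionRing (MvPolynomial (Fin 2) ℚ)

/-- The indeterminate `v` of `ℚ(v, t)`. -/
noncomputable def vv : Qvt := algebraMap (MvPolynomial (Fin 2) ℚ) Qvt (MvPolynomial.X 0)

/-- The indeterminate `t` of `ℚ(v, t)`. -/
noncomputable def tt : Qvt := algebraMap (MvPolynomial (Fin 2) ℚ) Qvt (MvPolynomial.X 1)

/-- The two-parameter quantum algebra `U_{v,t}(sl_n)` over `ℚ(v, t)`. -/
abbrev Uvt (n : ℕ) : Type := U Qvt n vv tt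

/-- `U⁻`, the subalgebra of `U_{v,t}(sl_n)` generated by the `F_i`. -/
noncomputable abbrev UvtNeg (n : ℕ) : Subalgebra Qvt (Uvt n) := Uneg Qvt n vv tt

/-- `U⁰`, the subalgebra of `U_{v,t}(sl_n)` generated by the `K_i^{±1}` and `K_i'^{±1}`. -/
noncomputable abbrev UvtZero (n : ℕ) : Subalgebra Qvt (Uvt n) := Uzero Qvt n vv tt

/-- `U⁺`, the subalgebra of `U_{v,t}(sl_n)` generated by the `E_i`. -/
noncomputable abbrev UvtPos (n : ℕ) : Subalgebra Qvt (Uvt n) := Upos Qvt n vv tt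

end TwoParamQuantum

namespace TwoParamQuantum

section Presented

variable {k : Type} [Field k] {X : Type} (r : FreeAlgebra k X → FreeAlgebra k X → Prop)

/-- The image of a generator in a presented algebra. -/
def presGen (x : X) : RingQuot r := RingQuot.mkAlgHom k r (FreeAlgebra.ι k x)

theorem presented_induction (S : Submodule k (RingQuot r)) (h1 : 1 ∈ S)
    (hmul : ∀ x a, a ∈ S → presGen r x * a ∈ S) (a : RingQuot r) : a ∈ S := by
  obtain ⟨a, rfl⟩ := RingQuot.mkAlgHom_surjective k r a
  have key : ∀ b ∈ S, RingQuot.mkAlgHom k r a * b ∈ S := by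
    induction a using FreeAlgebra.induction with
    | grade0 c =>
      intro b hb
      rw [AlgHom.commutes, ← Algebra.smul_def]
      exact S.smul_mem c hb
    | grade1 x => exact fun b hb => hmul x b hb
    | mul a b ha hb =>
      intro c hc
      rw [map_mul, mul_assoc]
      exact ha _ (hb _ hc)
    | add a b ha hb =>
      intro c hc
      rw [map_add, add_mul]
      exact S.add_mem (ha _ hc) (hb _ hc)
  simpa using key 1 h1

variable {r} {A : Type*} [Ring A] [Algebra k A]

theorem presented_linearMap_ext {V : Type*} [AddCommGroup V] [Module k V]
    {f g : RingQuot r →ₗ[k] V} (h1 : f 1 = g 1)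
    (hmul : ∀ x a, f a = g a → f (presGen r x * a) = g (presGen r x * a)) (a : RingQuot r) :
    f a = g a :=
  presented_induction r (LinearMap.eqLocus f g) h1 hmul a

theorem presented_algHom_ext {f g : RingQuot r →ₐ[k] A}
    (h : ∀ x, f (presGen r x) = g (presGen r x)) : f = g := by
  apply RingQuot.ringQuot_ext'
  apply FreeAlgebra.hom_ext
  funext x
  exact h x

/-- The universal property of a presented algebra. -/
noncomputable def presLift (f : X → A)
    (h : ∀ ⦃a b⦄, r a b → FreeAlgebra.lift k f a = FreeAlgebra.lift k f b) :
    RingQuot r →ₐ[k] A :=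
  RingQuot.liftAlgHom k ⟨FreeAlgebra.lift k f, h⟩

@[simp]
theorem presLift_gen (f : X → A)
    (h : ∀ ⦃a b⦄, r a b → FreeAlgebra.lift k f a = FreeAlgebra.lift k f b) (x : X) :
    presLift f h (presGen r x) = f x := by
  simp [presLift, presGen]

theorem presLift_range (f : X → A)
    (h : ∀ ⦃a b⦄, r a b → FreeAlgebra.lift k f a = FreeAlgebra.lift k f b) :
    (presLift f h).range = Algebra.adjoin k (Set.range f) := by
  rw [Algebra.adjoin_range_eq_range_freeAlgebra_lift]
  ext y
  constructor
  · rintro ⟨x, rfl⟩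
    obtain ⟨a, rfl⟩ := RingQuot.mkAlgHom_surjective k r x
    exact ⟨a, by simp [presLift]⟩
  · rintro ⟨a, rfl⟩
    exact ⟨RingQuot.mkAlgHom k r a, by simp [presLift]⟩

theorem presGen_rel {a b : FreeAlgebra k X} (h : r a b) :
    FreeAlgebra.lift k (presGen r) a = FreeAlgebra.lift k (presGen r) b := by
  have : FreeAlgebra.lift k (presGen r) = RingQuot.mkAlgHom k r := by
    apply FreeAlgebra.hom_ext
    funext x
    simp [presGen]
  rw [this]
  exact RingQuot.mkAlgHom_rel k h

end Presented

section Weights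

variable {k : Type} [Field k] {n : ℕ}

/-- The weight of `E_j` under `K_i` (for `inl i`) and under `K_i'` (for `inr i`). -/
def weight (v t : kˣ) (p : Fin (n - 1) ⊕ Fin (n - 1)) (j : Fin (n - 1)) : kˣ :=
  Sum.elim (fun i => v ^ dot i j * t ^ skew i j) (fun i => v ^ (-dot i j) * t ^ skew i j) p

/-- The index `i` of `K_i` or `K_i'`. -/
def node (p : Fin (n - 1) ⊕ Fin (n - 1)) : Fin (n - 1) := Sum.elim id id p

theorem skew_swap (i j : Fin (n - 1)) : skew j i = -skew i j := by
  simp [skew]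

theorem weight_inv (v t : kˣ) (p : Fin (n - 1) ⊕ Fin (n - 1)) (j : Fin (n - 1)) :
    weight v t⁻¹ p.swap j = (weight v t p j)⁻¹ := by
  rcases p with i | i <;> simp [weight, mul_comm]

theorem weight_of_far (v t : kˣ) (p : Fin (n - 1) ⊕ Fin (n - 1)) (j : Fin (n - 1))
    (h : (node p : ℕ) + 1 < j ∨ (j : ℕ) + 1 < node p) : weight v t p j = 1 := by
  rcases p with i | i <;>
  · simp only [node, Sum.elim_inl, Sum.elim_inr, id] at h
    have h1 : ¬ i = j := by rintro rfl; omega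
    have h2 : ¬ j = i := by rintro rfl; omega
    have h3 : ¬ (i : ℕ) = j + 1 := by omega
    have h4 : ¬ (j : ℕ) = i + 1 := by omega
    simp [weight, dot, skew, Ω, h1, h2, h3, h4]

theorem dot_self (i : Fin (n - 1)) : dot i i = 2 := by simp [dot, Ω]

theorem skew_self (i : Fin (n - 1)) : skew i i = 0 := by simp [skew]

theorem dot_succ {i j : Fin (n - 1)} (h : (j : ℕ) = i + 1) : dot i j = -1 := by
  have h1 : ¬ i = j := by rintro rfl; omega
  have h2 : ¬ j = i := by rintro rfl; omega
  have h3 : ¬ (i : ℕ) = j + 1 := by omega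
  simp only [dot, Ω, h1, h2, h3, if_pos h, if_false]
  norm_num

theorem dot_comm (i j : Fin (n - 1)) : dot i j = dot j i := by simp [dot, add_comm]

theorem skew_succ {i j : Fin (n - 1)} (h : (j : ℕ) = i + 1) : skew i j = 1 := by
  have h1 : ¬ i = j := by rintro rfl; omega
  have h2 : ¬ j = i := by rintro rfl; omega
  have h3 : ¬ (i : ℕ) = j + 1 := by omega
  simp only [skew, Ω, h1, h2, h3, if_pos h, if_false]
  norm_num

/-- The scalar identities behind the Serre relations, seen from the first node. -/
theorem weight_serre_fst (v t : kˣ) (p : Fin (n - 1) ⊕ Fin (n - 1)) (j : Fin (n - 1))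
    (h : (j : ℕ) = (node p : ℕ) + 1) :
    let s : k := weight v t p (node p)
    let s' : k := weight v t p j
    let a : k := t * (v + (v : k)⁻¹)
    (1 + s) * s' = a ∧ a * s * s' = t ^ 2 * (1 + s) ∧ s' ^ 2 - a * s' + t ^ 2 = 0 := by
  have hv := v.ne_zero
  have ht := t.ne_zero
  rcases p with i | i <;>
  · simp only [node, Sum.elim_inl, Sum.elim_inr, id] at h
    simp only [weight, node, Sum.elim_inl, Sum.elim_inr, id, dot_self, skew_self, dot_succ h,
      skew_succ h]
    push_cast
    simp only [zpow_neg, zpow_ofNat]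
    refine ⟨?_, ?_, ?_⟩ <;> field_simp <;> ring

/-- The scalar identities behind the Serre relations, seen from the second node. -/
theorem weight_serre_snd (v t : kˣ) (p : Fin (n - 1) ⊕ Fin (n - 1)) (i : Fin (n - 1))
    (h : (node p : ℕ) = (i : ℕ) + 1) :
    let s : k := weight v t p (node p)
    let s' : k := weight v t p i
    let a : k := t * (v + (v : k)⁻¹)
    1 + s = a * s * s' ∧ t ^ 2 * (1 + s) * s' = a ∧ 1 - a * s' + t ^ 2 * s' ^ 2 = 0 := by
  have hv := v.ne_zero
  have ht := t.ne_zero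
  rcases p with j | j <;>
  · simp only [node, Sum.elim_inl, Sum.elim_inr, id] at h
    simp only [weight, node, Sum.elim_inl, Sum.elim_inr, id, dot_self, skew_self,
      dot_comm j i, dot_succ h, skew_swap i j, skew_succ h]
    push_cast
    simp only [zpow_neg, zpow_ofNat]
    refine ⟨?_, ?_, ?_⟩ <;> field_simp <;> ring

end Weights

section Serre

variable {k : Type} [Field k] {n : ℕ} {A : Type*} [Ring A] [Algebra k A]

/-- The family `x` satisfies the relations of the `E_i` among themselves. -/
structure IsSerre (v t : k) (x : Fin (n - 1) → A) : Prop where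
  comm : ∀ i j : Fin (n - 1), (i : ℕ) + 1 < j ∨ (j : ℕ) + 1 < i → x i * x j - x j * x i = 0
  serre₁ : ∀ i j : Fin (n - 1), (j : ℕ) = (i : ℕ) + 1 →
    x i ^ 2 * x j - (t * (v + v⁻¹)) • (x i * x j * x i) + t ^ 2 • (x j * x i ^ 2) = 0
  serre₂ : ∀ i j : Fin (n - 1), (j : ℕ) = (i : ℕ) + 1 →
    x i * x j ^ 2 - (t * (v + v⁻¹)) • (x j * x i * x j) + t ^ 2 • (x j ^ 2 * x i) = 0

theorem IsSerre.map {B : Type*} [Ring B] [Algebra k B] {v t : k} {x : Fin (n - 1) → A}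
    (h : IsSerre v t x) (f : A →ₐ[k] B) : IsSerre v t fun i => f (x i) where
  comm i j hij := by simpa using congrArg f (h.comm i j hij)
  serre₁ i j hij := by simpa using congrArg f (h.serre₁ i j hij)
  serre₂ i j hij := by simpa using congrArg f (h.serre₂ i j hij)

theorem IsSerre.smul {v t : k} {x : Fin (n - 1) → A} (h : IsSerre v t x) (s : Fin (n - 1) → k) :
    IsSerre v t fun i => s i • x i where
  comm i j hij := by
    have := congrArg (fun z => (s i * s j) • z) (h.comm i j hij)
    simp only [smul_zero] at this
    rw [← this]
    simp only [smul_mul_assoc, mul_smul_comm]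
    module
  serre₁ i j hij := by
    have := congrArg (fun z => (s i ^ 2 * s j) • z) (h.serre₁ i j hij)
    simp only [smul_zero] at this
    rw [← this]
    simp only [smul_mul_assoc, mul_smul_comm, smul_pow]
    module
  serre₂ i j hij := by
    have := congrArg (fun z => (s i * s j ^ 2) • z) (h.serre₂ i j hij)
    simp only [smul_zero] at this
    rw [← this]
    simp only [smul_mul_assoc, mul_smul_comm, smul_pow]
    module

/-- The relations `IsSerre` in the free algebra. -/
inductive SerreRel (v t : k) :
    FreeAlgebra k (Fin (n - 1)) → FreeAlgebra k (Fin (n - 1)) → Prop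
  | comm (i j : Fin (n - 1)) (h : (i : ℕ) + 1 < j ∨ (j : ℕ) + 1 < i) :
      SerreRel v t (FreeAlgebra.ι k i * FreeAlgebra.ι k j -
        FreeAlgebra.ι k j * FreeAlgebra.ι k i) 0
  | serre₁ (i j : Fin (n - 1)) (h : (j : ℕ) = (i : ℕ) + 1) :
      SerreRel v t (FreeAlgebra.ι k i ^ 2 * FreeAlgebra.ι k j -
        (t * (v + v⁻¹)) • (FreeAlgebra.ι k i * FreeAlgebra.ι k j * FreeAlgebra.ι k i) +
        t ^ 2 • (FreeAlgebra.ι k j * FreeAlgebra.ι k i ^ 2)) 0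
  | serre₂ (i j : Fin (n - 1)) (h : (j : ℕ) = (i : ℕ) + 1) :
      SerreRel v t (FreeAlgebra.ι k i * FreeAlgebra.ι k j ^ 2 -
        (t * (v + v⁻¹)) • (FreeAlgebra.ι k j * FreeAlgebra.ι k i * FreeAlgebra.ι k j) +
        t ^ 2 • (FreeAlgebra.ι k j ^ 2 * FreeAlgebra.ι k i)) 0

variable (n) in
/-- The algebra with generators `x_i` subject to the relations `IsSerre`. -/
def SerreAlg (v t : k) : Type := RingQuot (SerreRel (n := n) v t)

noncomputable instance (v t : k) : Ring (SerreAlg n v t) :=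
  inferInstanceAs (Ring (RingQuot (SerreRel (n := n) v t)))

noncomputable instance (v t : k) : Algebra k (SerreAlg n v t) :=
  inferInstanceAs (Algebra k (RingQuot (SerreRel (n := n) v t)))

/-- The generators of `SerreAlg`. -/
def SerreAlg.gen (v t : k) (i : Fin (n - 1)) : SerreAlg n v t := presGen (SerreRel v t) i

theorem SerreAlg.linearMap_ext {v t : k} {V : Type*} [AddCommGroup V] [Module k V]
    {f g : SerreAlg n v t →ₗ[k] V} (h1 : f 1 = g 1)
    (hmul : ∀ i a, f a = g a → f (SerreAlg.gen v t i * a) = g (SerreAlg.gen v t i * a))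
    (a : SerreAlg n v t) : f a = g a :=
  presented_linearMap_ext h1 hmul a

theorem SerreAlg.algHom_ext {v t : k} {f g : SerreAlg n v t →ₐ[k] A}
    (h : ∀ i, f (SerreAlg.gen v t i) = g (SerreAlg.gen v t i)) : f = g :=
  presented_algHom_ext h

theorem isSerre_presGen (v t : k) : IsSerre v t (presGen (SerreRel (n := n) v t)) where
  comm i j h := by simpa using presGen_rel (SerreRel.comm (v := v) (t := t) i j h)
  serre₁ i j h := by simpa using presGen_rel (SerreRel.serre₁ (v := v) (t := t) i j h)
  serre₂ i j h := by simpa using presGen_rel (SerreRel.serre₂ (v := v) (t := t) i j h)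

theorem SerreAlg.isSerre_gen (v t : k) : IsSerre v t (SerreAlg.gen (n := n) v t) :=
  isSerre_presGen v t

/-- The universal property of `SerreAlg`. -/
noncomputable def SerreAlg.lift {v t : k} (x : Fin (n - 1) → A) (hx : IsSerre v t x) :
    SerreAlg n v t →ₐ[k] A :=
  presLift x (by
    intro a b h
    induction h with
    | comm i j h => simpa using hx.comm i j h
    | serre₁ i j h => simpa using hx.serre₁ i j h
    | serre₂ i j h => simpa using hx.serre₂ i j h)

@[simp]
theorem SerreAlg.lift_gen {v t : k} (x : Fin (n - 1) → A) (hx : IsSerre v t x)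
    (i : Fin (n - 1)) : SerreAlg.lift x hx (SerreAlg.gen v t i) = x i :=
  presLift_gen _ _ _

theorem SerreAlg.lift_range {v t : k} (x : Fin (n - 1) → A) (hx : IsSerre v t x) :
    (SerreAlg.lift x hx).range = Algebra.adjoin k (Set.range x) :=
  presLift_range _ _

/-- The endomorphism of `SerreAlg` multiplying each generator by a scalar. -/
noncomputable def SerreAlg.scale {v t : k} (s : Fin (n - 1) → k) :
    SerreAlg n v t →ₐ[k] SerreAlg n v t :=
  SerreAlg.lift _ ((SerreAlg.isSerre_gen v t).smul s)

@[simp]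
theorem SerreAlg.scale_gen {v t : k} (s : Fin (n - 1) → k) (i : Fin (n - 1)) :
    SerreAlg.scale s (SerreAlg.gen v t i) = s i • SerreAlg.gen v t i :=
  SerreAlg.lift_gen _ _ _

theorem SerreAlg.scale_scale {v t : k} (s s' : Fin (n - 1) → k) (x : SerreAlg n v t) :
    SerreAlg.scale s (SerreAlg.scale s' x) = SerreAlg.scale (s * s') x := by
  have : (SerreAlg.scale s).comp (SerreAlg.scale s') =
      (SerreAlg.scale (s * s') : SerreAlg n v t →ₐ[k] _) := by
    refine SerreAlg.algHom_ext fun i => ?_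
    simp [smul_smul, mul_comm]
  exact DFunLike.congr_fun this x

theorem SerreAlg.scale_one {v t : k} (x : SerreAlg n v t) :
    SerreAlg.scale (1 : Fin (n - 1) → k) x = x := by
  have : SerreAlg.scale (1 : Fin (n - 1) → k) = AlgHom.id k (SerreAlg n v t) := by
    refine SerreAlg.algHom_ext fun i => ?_
    simp
  exact DFunLike.congr_fun this x

/-- The upper triangular matrix with diagonal `a, b` and off-diagonal entry `d`. -/
def upperTri (a d b : A) : Matrix (Fin 2) (Fin 2) A := !![a, d; 0, b]

theorem upperTri_mul (a d b a' d' b' : A) :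
    upperTri a d b * upperTri a' d' b' = upperTri (a * a') (a * d' + d * b') (b * b') := by
  simp [upperTri]

theorem upperTri_add (a d b a' d' b' : A) :
    upperTri a d b + upperTri a' d' b' = upperTri (a + a') (d + d') (b + b') := by
  simp [upperTri]

theorem upperTri_sub (a d b a' d' b' : A) :
    upperTri a d b - upperTri a' d' b' = upperTri (a - a') (d - d') (b - b') := by
  ext i j
  fin_cases i <;> fin_cases j <;> simp [upperTri]

theorem upperTri_smul (c : k) (a d b : A) :
    c • upperTri a d b = upperTri (c • a) (c • d) (c • b) := by
  simp [upperTri]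

theorem upperTri_zero : upperTri (0 : A) 0 0 = 0 := by
  ext i j
  fin_cases i <;> fin_cases j <;> simp [upperTri]

theorem IsSerre.upperTri {v t : kˣ} (p : Fin (n - 1) ⊕ Fin (n - 1)) {x : Fin (n - 1) → A}
    (h : IsSerre (v : k) (t : k) x) :
    IsSerre (v : k) (t : k) fun j => upperTri (x j) (if node p = j then 1 else 0)
      ((weight v t p j : k) • x j) := by
  have hs := h.smul fun j => (weight v t p j : k)
  refine ⟨fun i j hij => ?_, fun i j hij => ?_, fun i j hij => ?_⟩
  · have h₀ := h.comm i j hij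
    have h₁ := hs.comm i j hij
    have hne : i ≠ j := by rintro rfl; omega
    simp only [upperTri_mul, upperTri_sub]
    rw [h₀, h₁, ← upperTri_zero]
    congr 1
    by_cases hi : node p = i
    · subst hi
      simp [hne, weight_of_far v t p j hij]
    · by_cases hj : node p = j
      · subst hj
        simp [hne.symm, weight_of_far v t p i hij.symm]
      · simp [hi, hj]
  · have h₀ := h.serre₁ i j hij
    have h₁ := hs.serre₁ i j hij
    have hne : i ≠ j := by rintro rfl; omega
    simp only [pow_two (x _), pow_two (_ • x _)] at h₀ h₁
    simp only [pow_two (TwoParamQuantum.upperTri _ _ _), upperTri_mul, upperTri_sub, upperTri_add,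
      upperTri_smul]
    rw [h₀, h₁, ← upperTri_zero]
    congr 1
    by_cases hi : node p = i
    · subst hi
      obtain ⟨e₁, e₂, -⟩ := weight_serre_fst v t p j hij
      simp only [hne, if_true, if_false, mul_one, one_mul, mul_zero, smul_zero, zero_mul, add_zero,
        zero_add,
        smul_mul_assoc, mul_smul_comm, mul_add, add_mul]
      match_scalars
      · linear_combination e₁
      · linear_combination -e₂
    · by_cases hj : node p = j
      · subst hj
        obtain ⟨-, -, e₃⟩ := weight_serre_snd v t p i hij
        simp only [hne.symm, if_true, if_false, mul_one, one_mul, mul_zero, smul_zero, zero_mul, add_zero,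
          zero_add, smul_mul_assoc, mul_smul_comm]
        match_scalars
        linear_combination e₃
      · simp [hi, hj]
  · have h₀ := h.serre₂ i j hij
    have h₁ := hs.serre₂ i j hij
    have hne : i ≠ j := by rintro rfl; omega
    simp only [pow_two (x _), pow_two (_ • x _)] at h₀ h₁
    simp only [pow_two (TwoParamQuantum.upperTri _ _ _), upperTri_mul, upperTri_sub, upperTri_add,
      upperTri_smul]
    rw [h₀, h₁, ← upperTri_zero]
    congr 1
    by_cases hi : node p = i
    · subst hi
      obtain ⟨-, -, e₃⟩ := weight_serre_fst v t p j hij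
      simp only [hne, if_true, if_false, mul_one, one_mul, mul_zero, smul_zero, zero_mul, add_zero,
        zero_add,
        smul_mul_assoc, mul_smul_comm]
      match_scalars
      linear_combination e₃
    · by_cases hj : node p = j
      · subst hj
        obtain ⟨e₁, e₂, -⟩ := weight_serre_snd v t p i hij
        simp only [hne.symm, if_true, if_false, mul_one, one_mul, mul_zero, smul_zero, zero_mul, add_zero,
          zero_add, smul_mul_assoc, mul_smul_comm, mul_add, add_mul]
        match_scalars
        · linear_combination e₁
        · linear_combination e₂
      · simp [hi, hj]

/-- The homomorphism `x ↦ (x, r x; 0, D x)` with `D` the scaling by the weights at `p` and `r` the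
corresponding skew derivation. -/
noncomputable def SerreAlg.triHom (v t : kˣ) (p : Fin (n - 1) ⊕ Fin (n - 1)) :
    SerreAlg n (v : k) (t : k) →ₐ[k] Matrix (Fin 2) (Fin 2) (SerreAlg n (v : k) (t : k)) :=
  SerreAlg.lift _ ((SerreAlg.isSerre_gen (v : k) (t : k)).upperTri p)

/-- The scaling of `SerreAlg` by the weights at `p`. -/
noncomputable def SerreAlg.wt (v t : kˣ) (p : Fin (n - 1) ⊕ Fin (n - 1)) :
    SerreAlg n (v : k) (t : k) →ₐ[k] SerreAlg n (v : k) (t : k) :=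
  SerreAlg.scale fun j => (weight v t p j : k)

/-- The skew derivation of `SerreAlg` at `p`. -/
noncomputable def SerreAlg.der (v t : kˣ) (p : Fin (n - 1) ⊕ Fin (n - 1)) :
    SerreAlg n (v : k) (t : k) →ₗ[k] SerreAlg n (v : k) (t : k) where
  toFun x := SerreAlg.triHom v t p x 0 1
  map_add' x y := by simp
  map_smul' c x := by simp

@[simp]
theorem SerreAlg.der_one (v t : kˣ) (p : Fin (n - 1) ⊕ Fin (n - 1)) :
    SerreAlg.der (k := k) v t p 1 = 0 := by
  simp [SerreAlg.der]

theorem SerreAlg.triHom_one_one (v t : kˣ) (p : Fin (n - 1) ⊕ Fin (n - 1))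
    (x : SerreAlg n (v : k) (t : k)) : SerreAlg.triHom v t p x 1 1 = SerreAlg.wt v t p x := by
  let e : SerreAlg n (v : k) (t : k) →ₗ[k] SerreAlg n (v : k) (t : k) :=
    { toFun := fun x => SerreAlg.triHom v t p x 1 1
      map_add' := by simp
      map_smul' := by simp }
  refine SerreAlg.linearMap_ext (f := e) (g := (SerreAlg.wt v t p).toLinearMap) ?_ ?_ x
  · simp [e]
  · intro j a ha
    have h₁ : SerreAlg.triHom v t p (SerreAlg.gen _ _ j) = _ := SerreAlg.lift_gen _ _ _
    have h₂ : SerreAlg.wt v t p (SerreAlg.gen _ _ j) = _ := SerreAlg.scale_gen _ _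
    change SerreAlg.triHom v t p (SerreAlg.gen _ _ j * a) 1 1 =
      SerreAlg.wt v t p (SerreAlg.gen _ _ j * a)
    change SerreAlg.triHom v t p a 1 1 = SerreAlg.wt v t p a at ha
    rw [map_mul, map_mul, h₁, h₂, Matrix.mul_apply, Fin.sum_univ_two, ha]
    simp [TwoParamQuantum.upperTri]

theorem SerreAlg.der_gen_mul (v t : kˣ) (p : Fin (n - 1) ⊕ Fin (n - 1)) (j : Fin (n - 1))
    (x : SerreAlg n (v : k) (t : k)) :
    SerreAlg.der v t p (SerreAlg.gen _ _ j * x) =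
      SerreAlg.gen _ _ j * SerreAlg.der v t p x +
        if node p = j then SerreAlg.wt v t p x else 0 := by
  have : SerreAlg.triHom v t p (SerreAlg.gen _ _ j) = _ := SerreAlg.lift_gen _ _ _
  simp only [SerreAlg.der, LinearMap.coe_mk, AddHom.coe_mk, map_mul, this, Matrix.mul_apply,
    Fin.sum_univ_two]
  simp [TwoParamQuantum.upperTri, SerreAlg.triHom_one_one]

end Serre

section Cartan

variable {k : Type} [Field k] {n : ℕ} {A : Type*} [Ring A] [Algebra k A]

/-- The family `κ` satisfies the relations of the `K_i^{±1}` and `K_i'^{±1}`. -/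
structure IsCartan (κ : Fin (n - 1) ⊕ Fin (n - 1) → ℤˣ → A) : Prop where
  comm : ∀ p ε q δ, κ p ε * κ q δ = κ q δ * κ p ε
  inv : ∀ p ε, κ p ε * κ p (-ε) = 1

theorem IsCartan.smul {κ : Fin (n - 1) ⊕ Fin (n - 1) → ℤˣ → A} (h : IsCartan κ)
    (s : Fin (n - 1) ⊕ Fin (n - 1) → kˣ) :
    IsCartan fun p ε => ((s p ^ (ε : ℤ) : kˣ) : k) • κ p ε where
  comm p ε q δ := by
    simp only [smul_mul_assoc, mul_smul_comm, h.comm p ε q δ]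
    rw [smul_comm]
  inv p ε := by
    simp only [smul_mul_assoc, mul_smul_comm, h.inv p ε, smul_smul, ← Units.val_mul, ← zpow_add]
    simp

theorem IsCartan.mul_mul_cancel {κ : Fin (n - 1) ⊕ Fin (n - 1) → ℤˣ → A} (h : IsCartan κ)
    (p : Fin (n - 1) ⊕ Fin (n - 1)) (a : A) : κ p 1 * (κ p (-1) * a) = a := by
  rw [← mul_assoc, h.inv, one_mul]

theorem IsCartan.conj {κ : Fin (n - 1) ⊕ Fin (n - 1) → ℤˣ → A} (h : IsCartan κ)
    (p q : Fin (n - 1) ⊕ Fin (n - 1)) (ε : ℤˣ) (a : A) :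
    κ p 1 * (κ q ε * (κ p (-1) * a)) = κ q ε * a := by
  rw [← mul_assoc, h.comm, mul_assoc, h.mul_mul_cancel]

theorem IsCartan.mul_eq_of_conj {κ : Fin (n - 1) ⊕ Fin (n - 1) → ℤˣ → A} (h : IsCartan κ)
    {p : Fin (n - 1) ⊕ Fin (n - 1)} {a : A} {s : kˣ}
    (ha : κ p 1 * a * κ p (-1) = (s : k) • a) (ε : ℤˣ) :
    κ p ε * a = ((s ^ (ε : ℤ) : kˣ) : k) • (a * κ p ε) := by
  have h' : κ p (-1) * κ p 1 = 1 := by rw [h.comm, h.inv]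
  have h₁ : κ p 1 * a = (s : k) • (a * κ p 1) := by
    rw [← smul_mul_assoc, ← ha, mul_assoc _ (κ p (-1)), h', mul_one]
  rcases Int.units_eq_one_or ε with rfl | rfl
  · simpa using h₁
  · have := congrArg (fun z => ((s⁻¹ : kˣ) : k) • (κ p (-1) * z * κ p (-1))) h₁
    simp only [mul_smul_comm, smul_mul_assoc, smul_smul] at this
    rw [← mul_assoc, h', one_mul, ← mul_assoc, mul_assoc _ (κ p 1), h.inv, mul_one] at this
    simpa using this.symm

/-- The relations `IsCartan` in the free algebra. -/
inductive CartanRel (k : Type) [Field k] (n : ℕ) :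
    FreeAlgebra k ((Fin (n - 1) ⊕ Fin (n - 1)) × ℤˣ) →
    FreeAlgebra k ((Fin (n - 1) ⊕ Fin (n - 1)) × ℤˣ) → Prop
  | comm (a b : (Fin (n - 1) ⊕ Fin (n - 1)) × ℤˣ) :
      CartanRel k n (FreeAlgebra.ι k a * FreeAlgebra.ι k b)
        (FreeAlgebra.ι k b * FreeAlgebra.ι k a)
  | inv (p : Fin (n - 1) ⊕ Fin (n - 1)) (ε : ℤˣ) :
      CartanRel k n (FreeAlgebra.ι k (p, ε) * FreeAlgebra.ι k (p, -ε)) 1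

variable (k n) in
/-- The algebra of Laurent polynomials in the `K_i` and `K_i'`, by generators and relations. -/
def CartanAlg : Type := RingQuot (CartanRel k n)

noncomputable instance : Ring (CartanAlg k n) :=
  inferInstanceAs (Ring (RingQuot (CartanRel k n)))

noncomputable instance : Algebra k (CartanAlg k n) :=
  inferInstanceAs (Algebra k (RingQuot (CartanRel k n)))

variable (k) in
/-- The generators of `CartanAlg`. -/
def CartanAlg.gen (p : Fin (n - 1) ⊕ Fin (n - 1)) (ε : ℤˣ) : CartanAlg k n :=
  presGen (CartanRel k n) (p, ε)

theorem CartanAlg.linearMap_ext {V : Type*} [AddCommGroup V] [Module k V]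
    {f g : CartanAlg k n →ₗ[k] V} (h1 : f 1 = g 1)
    (hmul : ∀ p ε a, f a = g a → f (CartanAlg.gen k p ε * a) = g (CartanAlg.gen k p ε * a))
    (a : CartanAlg k n) : f a = g a :=
  presented_linearMap_ext h1 (fun i => hmul i.1 i.2) a

theorem CartanAlg.algHom_ext {f g : CartanAlg k n →ₐ[k] A}
    (h : ∀ p ε, f (CartanAlg.gen k p ε) = g (CartanAlg.gen k p ε)) : f = g :=
  presented_algHom_ext fun i => h i.1 i.2

variable (k n) in
theorem isCartan_presGen : IsCartan fun p ε => presGen (CartanRel k n) (p, ε) where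
  comm p ε q δ := by
    simpa using presGen_rel (CartanRel.comm (k := k) (p, ε) (q, δ))
  inv p ε := by simpa using presGen_rel (CartanRel.inv (k := k) p ε)

variable (k n) in
theorem CartanAlg.isCartan_gen : IsCartan (CartanAlg.gen k (n := n)) :=
  isCartan_presGen k n

/-- The universal property of `CartanAlg`. -/
noncomputable def CartanAlg.lift (κ : Fin (n - 1) ⊕ Fin (n - 1) → ℤˣ → A) (h : IsCartan κ) :
    CartanAlg k n →ₐ[k] A :=
  presLift (fun a => κ a.1 a.2) (by
    intro a b hr
    induction hr with
    | comm a b => simpa using h.comm _ _ _ _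
    | inv p ε => simpa using h.inv p ε)

@[simp]
theorem CartanAlg.lift_gen (κ : Fin (n - 1) ⊕ Fin (n - 1) → ℤˣ → A) (h : IsCartan κ)
    (p : Fin (n - 1) ⊕ Fin (n - 1)) (ε : ℤˣ) :
    CartanAlg.lift κ h (CartanAlg.gen k p ε) = κ p ε :=
  presLift_gen _ _ _

theorem CartanAlg.lift_range (κ : Fin (n - 1) ⊕ Fin (n - 1) → ℤˣ → A) (h : IsCartan κ) :
    (CartanAlg.lift (k := k) κ h).range =
      Algebra.adjoin k (Set.range fun a : (Fin (n - 1) ⊕ Fin (n - 1)) × ℤˣ => κ a.1 a.2) :=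
  presLift_range _ _

/-- The endomorphism `T` of `CartanAlg` with `E_j y = T(y) E_j`. -/
noncomputable def CartanAlg.shift (v t : kˣ) (j : Fin (n - 1)) :
    CartanAlg k n →ₐ[k] CartanAlg k n :=
  CartanAlg.lift _ ((CartanAlg.isCartan_gen k n).smul fun p => (weight v t p j)⁻¹)

@[simp]
theorem CartanAlg.shift_gen (v t : kˣ) (j : Fin (n - 1)) (p : Fin (n - 1) ⊕ Fin (n - 1))
    (ε : ℤˣ) : CartanAlg.shift v t j (CartanAlg.gen k p ε) =
      (((weight v t p j)⁻¹ ^ (ε : ℤ) : kˣ) : k) • CartanAlg.gen k p ε :=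
  CartanAlg.lift_gen _ _ _ _

theorem CartanAlg.shift_comm (v t : kˣ) (i j : Fin (n - 1)) (y : CartanAlg k n) :
    CartanAlg.shift v t i (CartanAlg.shift v t j y) =
      CartanAlg.shift v t j (CartanAlg.shift v t i y) := by
  have : (CartanAlg.shift v t i).comp (CartanAlg.shift v t j) =
      ((CartanAlg.shift v t j).comp (CartanAlg.shift v t i) : CartanAlg k n →ₐ[k] _) := by
    refine CartanAlg.algHom_ext fun p ε => ?_
    change CartanAlg.shift v t i (CartanAlg.shift v t j (CartanAlg.gen k p ε)) =
      CartanAlg.shift v t j (CartanAlg.shift v t i (CartanAlg.gen k p ε))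
    simp only [CartanAlg.shift_gen, map_smul]
    rw [smul_comm]
  exact DFunLike.congr_fun this y

end Cartan

section Quantum

variable {k : Type} [Field k] {n : ℕ} {A : Type*} [Ring A] [Algebra k A]

/-- The families `E, F, κ` satisfy all defining relations of the two-parameter quantum algebra,
except possibly those among the `E_i`. -/
structure IsPreQuantum (v t : kˣ) (E F : Fin (n - 1) → A)
    (κ : Fin (n - 1) ⊕ Fin (n - 1) → ℤˣ → A) : Prop where
  cartan : IsCartan κ
  conj_E : ∀ p j, κ p 1 * E j * κ p (-1) = (weight v t p j : k) • E j
  conj_F : ∀ p j, κ p 1 * F j * κ p (-1) = ((weight v t p j)⁻¹ : kˣ).1 • F j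
  comm_EF : ∀ i j, E i * F j = F j * E i +
    if i = j then ((v : k) - (v : k)⁻¹)⁻¹ • (κ (.inl i) 1 - κ (.inr i) 1) else 0
  serre_F : IsSerre (v : k) ((t⁻¹ : kˣ) : k) F

/-- The element `x² y - a x y x + b y x²` commutes with `f` if `y` does, and if the commutator
of `x` and `f` is a combination of elements `K, K'` with suitable weights. -/
theorem serre₁_commute_fst {x y f K K' : A} {a b c s s' q q' : k}
    (hx : x * f = f * x + c • (K - K')) (hy : y * f = f * y)
    (hKx : K * x = s • (x * K)) (hKy : K * y = s' • (y * K))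
    (hKx' : K' * x = q • (x * K')) (hKy' : K' * y = q' • (y * K'))
    (e₁ : (1 + s) * s' = a) (e₂ : a * s * s' = b * (1 + s))
    (e₁' : (1 + q) * q' = a) (e₂' : a * q * q' = b * (1 + q)) :
    (x ^ 2 * y - a • (x * y * x) + b • (y * x ^ 2)) * f =
      f * (x ^ 2 * y - a • (x * y * x) + b • (y * x ^ 2)) := by
  have hx₂ : ∀ z, x * (f * z) = f * (x * z) + c • (K * z - K' * z) := fun z => by
    rw [← mul_assoc, hx, add_mul, mul_assoc, smul_mul_assoc, sub_mul]
  have hy₂ : ∀ z, y * (f * z) = f * (y * z) := fun z => by rw [← mul_assoc, hy, mul_assoc]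
  have hKx₂ : ∀ z, K * (x * z) = s • (x * (K * z)) := fun z => by
    rw [← mul_assoc, hKx, smul_mul_assoc, mul_assoc]
  have hKx₂' : ∀ z, K' * (x * z) = q • (x * (K' * z)) := fun z => by
    rw [← mul_assoc, hKx', smul_mul_assoc, mul_assoc]
  have hKy₂ : ∀ z, K * (y * z) = s' • (y * (K * z)) := fun z => by
    rw [← mul_assoc, hKy, smul_mul_assoc, mul_assoc]
  have hKy₂' : ∀ z, K' * (y * z) = q' • (y * (K' * z)) := fun z => by
    rw [← mul_assoc, hKy', smul_mul_assoc, mul_assoc]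
  simp only [pow_two, sub_mul, add_mul, mul_sub, mul_add, smul_mul_assoc, mul_smul_comm, mul_assoc,
    hx, hy, hx₂, hy₂, hKx, hKy, hKx', hKy', hKx₂, hKx₂', hKy₂, hKy₂', smul_add, smul_sub]
  match_scalars
  all_goals first
    | ring1
    | linear_combination c * e₁
    | linear_combination -c * e₁'
    | linear_combination -c * e₂
    | linear_combination c * e₂'

theorem serre₁_commute_snd {x y f K K' : A} {a b c s q : k}
    (hx : x * f = f * x) (hy : y * f = f * y + c • (K - K'))
    (hKx : K * x = s • (x * K)) (hKx' : K' * x = q • (x * K'))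
    (e : 1 - a * s + b * s ^ 2 = 0) (e' : 1 - a * q + b * q ^ 2 = 0) :
    (x ^ 2 * y - a • (x * y * x) + b • (y * x ^ 2)) * f =
      f * (x ^ 2 * y - a • (x * y * x) + b • (y * x ^ 2)) := by
  have hy₂ : ∀ z, y * (f * z) = f * (y * z) + c • (K * z - K' * z) := fun z => by
    rw [← mul_assoc, hy, add_mul, mul_assoc, smul_mul_assoc, sub_mul]
  have hx₂ : ∀ z, x * (f * z) = f * (x * z) := fun z => by rw [← mul_assoc, hx, mul_assoc]
  have hKx₂ : ∀ z, K * (x * z) = s • (x * (K * z)) := fun z => by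
    rw [← mul_assoc, hKx, smul_mul_assoc, mul_assoc]
  have hKx₂' : ∀ z, K' * (x * z) = q • (x * (K' * z)) := fun z => by
    rw [← mul_assoc, hKx', smul_mul_assoc, mul_assoc]
  simp only [pow_two, sub_mul, add_mul, mul_sub, mul_add, smul_mul_assoc, mul_smul_comm, mul_assoc,
    hx, hy, hx₂, hy₂, hKx, hKx', hKx₂, hKx₂', smul_add, smul_sub]
  match_scalars
  all_goals first
    | ring1
    | linear_combination c * e
    | linear_combination -c * e'

theorem serre₂_commute_fst {x y f K K' : A} {a b c s q : k}
    (hx : x * f = f * x + c • (K - K')) (hy : y * f = f * y)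
    (hKy : K * y = s • (y * K)) (hKy' : K' * y = q • (y * K'))
    (e : s ^ 2 - a * s + b = 0) (e' : q ^ 2 - a * q + b = 0) :
    (x * y ^ 2 - a • (y * x * y) + b • (y ^ 2 * x)) * f =
      f * (x * y ^ 2 - a • (y * x * y) + b • (y ^ 2 * x)) := by
  have hx₂ : ∀ z, x * (f * z) = f * (x * z) + c • (K * z - K' * z) := fun z => by
    rw [← mul_assoc, hx, add_mul, mul_assoc, smul_mul_assoc, sub_mul]
  have hy₂ : ∀ z, y * (f * z) = f * (y * z) := fun z => by rw [← mul_assoc, hy, mul_assoc]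
  have hKy₂ : ∀ z, K * (y * z) = s • (y * (K * z)) := fun z => by
    rw [← mul_assoc, hKy, smul_mul_assoc, mul_assoc]
  have hKy₂' : ∀ z, K' * (y * z) = q • (y * (K' * z)) := fun z => by
    rw [← mul_assoc, hKy', smul_mul_assoc, mul_assoc]
  simp only [pow_two, sub_mul, add_mul, mul_sub, mul_add, smul_mul_assoc, mul_smul_comm, mul_assoc,
    hx, hy, hx₂, hy₂, hKy, hKy', hKy₂, hKy₂', smul_add, smul_sub]
  match_scalars
  all_goals first
    | ring1
    | linear_combination c * e
    | linear_combination -c * e'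

theorem serre₂_commute_snd {x y f K K' : A} {a b c s s' q q' : k}
    (hx : x * f = f * x) (hy : y * f = f * y + c • (K - K'))
    (hKy : K * y = s • (y * K)) (hKx : K * x = s' • (x * K))
    (hKy' : K' * y = q • (y * K')) (hKx' : K' * x = q' • (x * K'))
    (e₁ : 1 + s = a * s * s') (e₂ : b * (1 + s) * s' = a)
    (e₁' : 1 + q = a * q * q') (e₂' : b * (1 + q) * q' = a) :
    (x * y ^ 2 - a • (y * x * y) + b • (y ^ 2 * x)) * f =
      f * (x * y ^ 2 - a • (y * x * y) + b • (y ^ 2 * x)) := by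
  have hy₂ : ∀ z, y * (f * z) = f * (y * z) + c • (K * z - K' * z) := fun z => by
    rw [← mul_assoc, hy, add_mul, mul_assoc, smul_mul_assoc, sub_mul]
  have hx₂ : ∀ z, x * (f * z) = f * (x * z) := fun z => by rw [← mul_assoc, hx, mul_assoc]
  have hKx₂ : ∀ z, K * (x * z) = s' • (x * (K * z)) := fun z => by
    rw [← mul_assoc, hKx, smul_mul_assoc, mul_assoc]
  have hKx₂' : ∀ z, K' * (x * z) = q' • (x * (K' * z)) := fun z => by
    rw [← mul_assoc, hKx', smul_mul_assoc, mul_assoc]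
  have hKy₂ : ∀ z, K * (y * z) = s • (y * (K * z)) := fun z => by
    rw [← mul_assoc, hKy, smul_mul_assoc, mul_assoc]
  have hKy₂' : ∀ z, K' * (y * z) = q • (y * (K' * z)) := fun z => by
    rw [← mul_assoc, hKy', smul_mul_assoc, mul_assoc]
  simp only [pow_two, sub_mul, add_mul, mul_sub, mul_add, smul_mul_assoc, mul_smul_comm, mul_assoc,
    hx, hy, hx₂, hy₂, hKx, hKx', hKx₂, hKx₂', hKy, hKy', hKy₂, hKy₂', smul_add, smul_sub]
  match_scalars
  all_goals first
    | ring1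
    | linear_combination c * e₁
    | linear_combination -c * e₁'
    | linear_combination c * e₂
    | linear_combination -c * e₂'

namespace IsPreQuantum

variable {v t : kˣ} {E F : Fin (n - 1) → A} {κ : Fin (n - 1) ⊕ Fin (n - 1) → ℤˣ → A}

theorem κ_mul_E (h : IsPreQuantum v t E F κ) (p : Fin (n - 1) ⊕ Fin (n - 1)) (ε : ℤˣ)
    (j : Fin (n - 1)) : κ p ε * E j = ((weight v t p j ^ (ε : ℤ) : kˣ) : k) • (E j * κ p ε) :=
  h.cartan.mul_eq_of_conj (h.conj_E p j) ε

theorem κ_mul_F (h : IsPreQuantum v t E F κ) (p : Fin (n - 1) ⊕ Fin (n - 1)) (ε : ℤˣ)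
    (j : Fin (n - 1)) :
    κ p ε * F j = (((weight v t p j)⁻¹ ^ (ε : ℤ) : kˣ) : k) • (F j * κ p ε) :=
  h.cartan.mul_eq_of_conj (h.conj_F p j) ε

theorem κ_one_mul_E (h : IsPreQuantum v t E F κ) (p : Fin (n - 1) ⊕ Fin (n - 1))
    (j : Fin (n - 1)) : κ p 1 * E j = (weight v t p j : k) • (E j * κ p 1) := by
  simpa using h.κ_mul_E p 1 j

theorem E_mul_F_self (h : IsPreQuantum v t E F κ) (i : Fin (n - 1)) :
    E i * F i = F i * E i + ((v : k) - (v : k)⁻¹)⁻¹ • (κ (.inl i) 1 - κ (.inr i) 1) := by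
  simpa using h.comm_EF i i

theorem E_mul_F_of_ne (h : IsPreQuantum v t E F κ) {i j : Fin (n - 1)} (hij : i ≠ j) :
    E i * F j = F j * E i := by
  simpa [hij] using h.comm_EF i j

theorem comm_commute (h : IsPreQuantum v t E F κ) {i j : Fin (n - 1)}
    (hij : (i : ℕ) + 1 < j ∨ (j : ℕ) + 1 < i) (l : Fin (n - 1)) :
    Commute (E i * E j - E j * E i) (F l) := by
  have hne : i ≠ j := by rintro rfl; omega
  have key : ∀ {i j : Fin (n - 1)}, ((i : ℕ) + 1 < j ∨ (j : ℕ) + 1 < i) → i ≠ j →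
      (E i * E j - E j * E i) * F i = F i * (E i * E j - E j * E i) := by
    intro i j hij hne
    have hi := h.E_mul_F_self i
    have hj := h.E_mul_F_of_ne hne.symm
    have hl := h.κ_one_mul_E (.inl i) j
    have hr := h.κ_one_mul_E (.inr i) j
    rw [weight_of_far v t (.inl i) j hij, Units.val_one, one_smul] at hl
    rw [weight_of_far v t (.inr i) j hij, Units.val_one, one_smul] at hr
    have hi₂ : ∀ z, E i * (F i * z) = F i * (E i * z) +
        ((v : k) - (v : k)⁻¹)⁻¹ • (κ (.inl i) 1 * z - κ (.inr i) 1 * z) := fun z => by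
      rw [← mul_assoc, hi, add_mul, mul_assoc, smul_mul_assoc, sub_mul]
    have hj₂ : ∀ z, E j * (F i * z) = F i * (E j * z) := fun z => by
      rw [← mul_assoc, hj, mul_assoc]
    simp only [sub_mul, mul_sub, mul_add, mul_assoc, hi, hj, hi₂, hj₂, hl, hr, mul_smul_comm]
    module
  by_cases hi : l = i
  · subst hi
    exact key hij hne
  by_cases hj : l = j
  · subst hj
    rw [← neg_sub]
    exact (show Commute _ _ from key hij.symm hne.symm).neg_left
  · have h₁ : Commute (E i) (F l) := h.E_mul_F_of_ne (Ne.symm hi)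
    have h₂ : Commute (E j) (F l) := h.E_mul_F_of_ne (Ne.symm hj)
    exact (h₁.mul_left h₂).sub_left (h₂.mul_left h₁)

theorem serre₁_commute (h : IsPreQuantum v t E F κ) {i j : Fin (n - 1)}
    (hij : (j : ℕ) = (i : ℕ) + 1) (l : Fin (n - 1)) :
    Commute (E i ^ 2 * E j - ((t : k) * (v + (v : k)⁻¹)) • (E i * E j * E i) +
      (t : k) ^ 2 • (E j * E i ^ 2)) (F l) := by
  have hne : i ≠ j := by rintro rfl; omega
  by_cases hi : l = i
  · subst hi
    obtain ⟨e₁, e₂, -⟩ := weight_serre_fst v t (.inl l) j hij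
    obtain ⟨e₁', e₂', -⟩ := weight_serre_fst v t (.inr l) j hij
    exact serre₁_commute_fst (h.E_mul_F_self l) (h.E_mul_F_of_ne hne.symm)
      (h.κ_one_mul_E _ _) (h.κ_one_mul_E _ _) (h.κ_one_mul_E _ _) (h.κ_one_mul_E _ _)
      e₁ e₂ e₁' e₂'
  by_cases hj : l = j
  · subst hj
    exact serre₁_commute_snd (h.E_mul_F_of_ne hne) (h.E_mul_F_self l)
      (h.κ_one_mul_E _ _) (h.κ_one_mul_E _ _)
      (weight_serre_snd v t (.inl l) i hij).2.2 (weight_serre_snd v t (.inr l) i hij).2.2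
  · have h₁ : Commute (E i) (F l) := h.E_mul_F_of_ne (Ne.symm hi)
    have h₂ : Commute (E j) (F l) := h.E_mul_F_of_ne (Ne.symm hj)
    exact ((((h₁.pow_left 2).mul_left h₂).sub_left
      (((h₁.mul_left h₂).mul_left h₁).smul_left _)).add_left
      ((h₂.mul_left (h₁.pow_left 2)).smul_left _))

theorem serre₂_commute (h : IsPreQuantum v t E F κ) {i j : Fin (n - 1)}
    (hij : (j : ℕ) = (i : ℕ) + 1) (l : Fin (n - 1)) :
    Commute (E i * E j ^ 2 - ((t : k) * (v + (v : k)⁻¹)) • (E j * E i * E j) +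
      (t : k) ^ 2 • (E j ^ 2 * E i)) (F l) := by
  have hne : i ≠ j := by rintro rfl; omega
  by_cases hi : l = i
  · subst hi
    exact serre₂_commute_fst (h.E_mul_F_self l) (h.E_mul_F_of_ne hne.symm)
      (h.κ_one_mul_E _ _) (h.κ_one_mul_E _ _)
      (weight_serre_fst v t (.inl l) j hij).2.2 (weight_serre_fst v t (.inr l) j hij).2.2
  by_cases hj : l = j
  · subst hj
    obtain ⟨e₁, e₂, -⟩ := weight_serre_snd v t (.inl l) i hij
    obtain ⟨e₁', e₂', -⟩ := weight_serre_snd v t (.inr l) i hij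
    exact serre₂_commute_snd (h.E_mul_F_of_ne hne) (h.E_mul_F_self l)
      (h.κ_one_mul_E _ _) (h.κ_one_mul_E _ _) (h.κ_one_mul_E _ _) (h.κ_one_mul_E _ _)
      e₁ e₂ e₁' e₂'
  · have h₁ : Commute (E i) (F l) := h.E_mul_F_of_ne (Ne.symm hi)
    have h₂ : Commute (E j) (F l) := h.E_mul_F_of_ne (Ne.symm hj)
    exact (((h₁.mul_left (h₂.pow_left 2)).sub_left
      (((h₂.mul_left h₁).mul_left h₂).smul_left _)).add_left
      (((h₂.pow_left 2).mul_left h₁).smul_left _))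

end IsPreQuantum

end Quantum

section Universal

variable {k : Type} [Field k] {n : ℕ} {A : Type*} [Ring A] [Algebra k A]

/-- Assemble families `E, F, κ` into a map on the generators. -/
def genMap (E F : Fin (n - 1) → A) (κ : Fin (n - 1) ⊕ Fin (n - 1) → ℤˣ → A) : Gen n → A
  | .E i => E i
  | .F i => F i
  | .K i ε => κ (.inl i) ε
  | .K' i ε => κ (.inr i) ε

/-- The universal property of the two-parameter quantum algebra. -/
noncomputable def quantumLift {v t : kˣ} {E F : Fin (n - 1) → A}
    {κ : Fin (n - 1) ⊕ Fin (n - 1) → ℤˣ → A} (h : IsPreQuantum v t E F κ)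
    (hE : IsSerre (v : k) (t : k) E) : U k n (v : k) (t : k) →ₐ[k] A :=
  presLift (genMap E F κ) (by
    intro a b hr
    induction hr with
    | K_comm i j ε δ => simpa [genMap] using h.cartan.comm _ _ _ _
    | K'_comm i j ε δ => simpa [genMap] using h.cartan.comm _ _ _ _
    | K_K'_comm i j ε δ => simpa [genMap] using h.cartan.comm _ _ _ _
    | K_inv i ε => simpa [genMap] using h.cartan.inv _ _
    | K'_inv i ε => simpa [genMap] using h.cartan.inv _ _
    | K_E i j => simpa [genMap, weight] using h.conj_E (.inl i) j
    | K'_E i j => simpa [genMap, weight] using h.conj_E (.inr i) j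
    | K_F i j => simpa [genMap, weight, skew_swap i j, mul_comm] using h.conj_F (.inl i) j
    | K'_F i j => simpa [genMap, weight, skew_swap i j, mul_comm] using h.conj_F (.inr i) j
    | E_F_same i => simpa [genMap, sub_eq_iff_eq_add'] using h.E_mul_F_self i
    | E_F_ne i j hij => simpa [genMap, sub_eq_zero] using h.E_mul_F_of_ne hij
    | E_comm i j hij => simpa [genMap] using hE.comm i j hij
    | F_comm i j hij => simpa [genMap] using h.serre_F.comm i j hij
    | E_serre₁ i j hij => simpa [genMap] using hE.serre₁ i j hij
    | E_serre₂ i j hij => simpa [genMap] using hE.serre₂ i j hij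
    | F_serre₁ i j hij => simpa [genMap] using h.serre_F.serre₁ i j hij
    | F_serre₂ i j hij => simpa [genMap] using h.serre_F.serre₂ i j hij)

@[simp]
theorem quantumLift_gen {v t : kˣ} {E F : Fin (n - 1) → A}
    {κ : Fin (n - 1) ⊕ Fin (n - 1) → ℤˣ → A} (h : IsPreQuantum v t E F κ)
    (hE : IsSerre (v : k) (t : k) E) (g : Gen n) :
    quantumLift h hE (gen k n v t g) = genMap E F κ g :=
  presLift_gen _ _ _

variable (v t : kˣ)

/-- The generators `E_i` of the quantum algebra. -/
def uE (i : Fin (n - 1)) : U k n (v : k) (t : k) := gen k n v t (.E i)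

/-- The generators `F_i` of the quantum algebra. -/
def uF (i : Fin (n - 1)) : U k n (v : k) (t : k) := gen k n v t (.F i)

/-- The generators `K_i^{±1}` and `K_i'^{±1}` of the quantum algebra. -/
def uK (p : Fin (n - 1) ⊕ Fin (n - 1)) (ε : ℤˣ) : U k n (v : k) (t : k) :=
  gen k n v t (Sum.elim (fun i => .K i ε) (fun i => .K' i ε) p)

theorem gen_rel {a b : FreeAlgebra k (Gen n)} (h : Rel k n (v : k) (t : k) a b) :
    FreeAlgebra.lift k (gen k n (v : k) (t : k)) a = FreeAlgebra.lift k (gen k n (v : k) t) b :=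
  presGen_rel h

theorem isSerre_uE : IsSerre (v : k) (t : k) (uE (n := n) v t) where
  comm i j h := by simpa [uE] using gen_rel v t (Rel.E_comm i j h)
  serre₁ i j h := by simpa [uE] using gen_rel v t (Rel.E_serre₁ i j h)
  serre₂ i j h := by simpa [uE] using gen_rel v t (Rel.E_serre₂ i j h)

theorem isPreQuantum_gen :
    IsPreQuantum (k := k) v t (uE (n := n) v t) (uF v t) (uK v t) where
  cartan :=
    { comm := by
        rintro (i | i) ε (j | j) δ
        · simpa [uK] using gen_rel v t (Rel.K_comm i j ε δ)
        · simpa [uK] using gen_rel v t (Rel.K_K'_comm i j ε δ)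
        · simpa [uK] using (gen_rel v t (Rel.K_K'_comm j i δ ε)).symm
        · simpa [uK] using gen_rel v t (Rel.K'_comm i j ε δ)
      inv := by
        rintro (i | i) ε
        · simpa [uK] using gen_rel v t (Rel.K_inv i ε)
        · simpa [uK] using gen_rel v t (Rel.K'_inv i ε) }
  conj_E := by
    rintro (i | i) j
    · simpa [uK, uE, weight] using gen_rel v t (Rel.K_E i j)
    · simpa [uK, uE, weight] using gen_rel v t (Rel.K'_E i j)
  conj_F := by
    rintro (i | i) j
    · simpa [uK, uF, weight, skew_swap i j, mul_comm] using gen_rel v t (Rel.K_F i j)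
    · simpa [uK, uF, weight, skew_swap i j, mul_comm] using gen_rel v t (Rel.K'_F i j)
  comm_EF i j := by
    by_cases hij : i = j
    · subst hij
      simpa [uK, uE, uF, sub_eq_iff_eq_add'] using gen_rel v t (Rel.E_F_same i)
    · simpa [uK, uE, uF, sub_eq_zero, hij] using gen_rel v t (Rel.E_F_ne i j hij)
  serre_F :=
    { comm := fun i j h => by simpa [uF] using gen_rel v t (Rel.F_comm i j h)
      serre₁ := fun i j h => by simpa [uF] using gen_rel v t (Rel.F_serre₁ i j h)
      serre₂ := fun i j h => by simpa [uF] using gen_rel v t (Rel.F_serre₂ i j h) }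

end Universal

section Model

variable {k : Type} [Field k] {n : ℕ} (v t : kˣ)

variable (n) in
/-- The space `N⁻ ⊗ C ⊗ N⁺` on which the quantum algebra will act. -/
abbrev Model : Type :=
  (SerreAlg n (v : k) ((t⁻¹ : kˣ) : k) ⊗[k] CartanAlg k n) ⊗[k] SerreAlg n (v : k) (t : k)

/-- Scaling of `N⁻` corresponding to conjugation by `K_p^ε`. -/
noncomputable def negWt (p : Fin (n - 1) ⊕ Fin (n - 1)) (ε : ℤˣ) :
    SerreAlg n (v : k) ((t⁻¹ : kˣ) : k) →ₐ[k] SerreAlg n (v : k) ((t⁻¹ : kˣ) : k) :=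
  SerreAlg.scale fun j => (((weight v t p j)⁻¹ ^ (ε : ℤ) : kˣ) : k)

/-- The component along `K_p` of the commutator of `E_i` with `N⁻`. -/
noncomputable def negDer (p : Fin (n - 1) ⊕ Fin (n - 1)) :
    SerreAlg n (v : k) ((t⁻¹ : kˣ) : k) →ₗ[k] SerreAlg n (v : k) ((t⁻¹ : kˣ) : k) :=
  SerreAlg.der v t⁻¹ p.swap

theorem negWt_gen (p : Fin (n - 1) ⊕ Fin (n - 1)) (ε : ℤˣ) (j : Fin (n - 1)) :
    negWt v t p ε (SerreAlg.gen _ _ j) =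
      (((weight v t p j)⁻¹ ^ (ε : ℤ) : kˣ) : k) • SerreAlg.gen _ _ j :=
  SerreAlg.scale_gen _ _

theorem negWt_comm (p q : Fin (n - 1) ⊕ Fin (n - 1)) (ε δ : ℤˣ)
    (x : SerreAlg n (v : k) ((t⁻¹ : kˣ) : k)) :
    negWt v t p ε (negWt v t q δ x) = negWt v t q δ (negWt v t p ε x) := by
  simp only [negWt, SerreAlg.scale_scale]
  rw [mul_comm]

theorem negWt_inv (p : Fin (n - 1) ⊕ Fin (n - 1)) (ε : ℤˣ)
    (x : SerreAlg n (v : k) ((t⁻¹ : kˣ) : k)) :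
    negWt v t p ε (negWt v t p (-ε) x) = x := by
  rw [negWt, negWt, SerreAlg.scale_scale]
  convert SerreAlg.scale_one x using 3
  funext j
  rw [Pi.mul_apply, ← Units.val_mul, ← zpow_add]
  simp

theorem negDer_one (p : Fin (n - 1) ⊕ Fin (n - 1)) : negDer (k := k) v t p 1 = 0 :=
  SerreAlg.der_one _ _ _

theorem negDer_gen_mul (p : Fin (n - 1) ⊕ Fin (n - 1)) (j : Fin (n - 1))
    (x : SerreAlg n (v : k) ((t⁻¹ : kˣ) : k)) :
    negDer v t p (SerreAlg.gen _ _ j * x) = SerreAlg.gen _ _ j * negDer v t p x +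
      if node p = j then negWt v t p 1 x else 0 := by
  have h₁ : node p.swap = node p := by cases p <;> rfl
  have h₂ : SerreAlg.wt v t⁻¹ p.swap = negWt v t p 1 := by
    simp [SerreAlg.wt, negWt, weight_inv]
  rw [negDer, SerreAlg.der_gen_mul, h₁, h₂]

theorem negDer_negWt (p q : Fin (n - 1) ⊕ Fin (n - 1)) (ε : ℤˣ)
    (x : SerreAlg n (v : k) ((t⁻¹ : kˣ) : k)) :
    negDer v t p (negWt v t q ε x) =
      (((weight v t q (node p))⁻¹ ^ (ε : ℤ) : kˣ) : k) • negWt v t q ε (negDer v t p x) := by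
  refine SerreAlg.linearMap_ext (f := negDer v t p ∘ₗ (negWt v t q ε).toLinearMap)
    (g := (((weight v t q (node p))⁻¹ ^ (ε : ℤ) : kˣ) : k) •
      (negWt v t q ε).toLinearMap ∘ₗ negDer v t p) ?_ ?_ x
  · simp [negDer_one]
  · intro j a ha
    change negDer v t p (negWt v t q ε a) =
      (((weight v t q (node p))⁻¹ ^ (ε : ℤ) : kˣ) : k) • negWt v t q ε (negDer v t p a) at ha
    change negDer v t p (negWt v t q ε (SerreAlg.gen _ _ j * a)) =
      (((weight v t q (node p))⁻¹ ^ (ε : ℤ) : kˣ) : k) •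
        negWt v t q ε (negDer v t p (SerreAlg.gen _ _ j * a))
    rw [map_mul, negWt_gen, smul_mul_assoc, map_smul, negDer_gen_mul, negDer_gen_mul, ha, map_add,
      map_mul, negWt_gen]
    by_cases hj : node p = j
    · subst hj
      simp only [if_true, negWt_comm v t p q]
      simp only [smul_mul_assoc, mul_smul_comm, smul_add]
    · simp only [hj, if_false, map_zero, add_zero, smul_mul_assoc, mul_smul_comm]
      rw [smul_comm]

/-- The action of `F_j` on the model. -/
noncomputable def opF (j : Fin (n - 1)) : Module.End k (Model n v t) :=
  TensorProduct.map (TensorProduct.map (LinearMap.mulLeft k (SerreAlg.gen _ _ j)) .id) .id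

/-- The action of `K_p^ε` on the model. -/
noncomputable def opK (p : Fin (n - 1) ⊕ Fin (n - 1)) (ε : ℤˣ) : Module.End k (Model n v t) :=
  TensorProduct.map (TensorProduct.map (negWt v t p ε).toLinearMap
    (LinearMap.mulLeft k (CartanAlg.gen k p ε))) .id

/-- The component along `K_p` of the action of `E_i` on the model. -/
noncomputable def opDer (p : Fin (n - 1) ⊕ Fin (n - 1)) : Module.End k (Model n v t) :=
  TensorProduct.map (TensorProduct.map (negDer v t p)
    (LinearMap.mulLeft k (CartanAlg.gen k p 1))) .id

/-- The component of the action of `E_i` on the model that leaves `N⁻` alone. -/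
noncomputable def opShift (i : Fin (n - 1)) : Module.End k (Model n v t) :=
  TensorProduct.map (TensorProduct.map .id (CartanAlg.shift v t i).toLinearMap)
    (LinearMap.mulLeft k (SerreAlg.gen _ _ i))

theorem conj_add_smul_sub {A : Type*} [Ring A] [Algebra k A] {a b s d d' : A} {w c : k}
    (hs : a * s * b = w • s) (hd : a * d * b = w • d) (hd' : a * d' * b = w • d') :
    a * (s + c • (d - d')) * b = w • (s + c • (d - d')) := by
  simp only [mul_add, add_mul, mul_sub, sub_mul, mul_smul_comm, smul_mul_assoc, hs, hd, hd']
  module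

theorem commutator_add_smul_sub {A : Type*} [Ring A] [Algebra k A] {s d d' f K K' : A} {c : k}
    {P : Prop} [Decidable P] (hs : s * f = f * s) (hd : d * f = f * d + if P then K else 0)
    (hd' : d' * f = f * d' + if P then K' else 0) :
    (s + c • (d - d')) * f = f * (s + c • (d - d')) + if P then c • (K - K') else 0 := by
  simp only [mul_add, add_mul, mul_sub, sub_mul, mul_smul_comm, smul_mul_assoc, hs, hd, hd']
  split_ifs <;> module

/-- The action of `E_i` on the model. -/
noncomputable def opE (i : Fin (n - 1)) : Module.End k (Model n v t) :=
  opShift v t i + ((v : k) - (v : k)⁻¹)⁻¹ • (opDer v t (.inl i) - opDer v t (.inr i))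

variable {v t} (x : SerreAlg n (v : k) ((t⁻¹ : kˣ) : k)) (y : CartanAlg k n)
  (z : SerreAlg n (v : k) (t : k))

theorem opF_tmul (j : Fin (n - 1)) :
    opF v t j ((x ⊗ₜ y) ⊗ₜ z) = ((SerreAlg.gen _ _ j * x) ⊗ₜ y) ⊗ₜ z := rfl

theorem opK_tmul (p : Fin (n - 1) ⊕ Fin (n - 1)) (ε : ℤˣ) :
    opK v t p ε ((x ⊗ₜ y) ⊗ₜ z) = (negWt v t p ε x ⊗ₜ (CartanAlg.gen k p ε * y)) ⊗ₜ z := rfl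

theorem opDer_tmul (p : Fin (n - 1) ⊕ Fin (n - 1)) :
    opDer v t p ((x ⊗ₜ y) ⊗ₜ z) = (negDer v t p x ⊗ₜ (CartanAlg.gen k p 1 * y)) ⊗ₜ z := rfl

theorem opShift_tmul (i : Fin (n - 1)) :
    opShift v t i ((x ⊗ₜ y) ⊗ₜ z) =
      (x ⊗ₜ CartanAlg.shift v t i y) ⊗ₜ (SerreAlg.gen _ _ i * z) := rfl

theorem opE_one_tmul (i : Fin (n - 1)) :
    opE v t i ((1 ⊗ₜ y) ⊗ₜ z) =
      (1 ⊗ₜ CartanAlg.shift v t i y) ⊗ₜ (SerreAlg.gen _ _ i * z) := by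
  simp [opE, opShift_tmul, opDer_tmul, negDer_one]

theorem opK_comm (p q : Fin (n - 1) ⊕ Fin (n - 1)) (ε δ : ℤˣ) :
    opK v t p ε * opK v t q δ = opK v t q δ * opK v t p ε := by
  refine TensorProduct.ext_threefold fun x y z => ?_
  simp only [Module.End.mul_apply, opK_tmul]
  rw [negWt_comm, ← mul_assoc, (CartanAlg.isCartan_gen k n).comm, mul_assoc]

theorem opK_inv (p : Fin (n - 1) ⊕ Fin (n - 1)) (ε : ℤˣ) :
    opK v t p ε * opK v t p (-ε) = 1 := by
  refine TensorProduct.ext_threefold fun x y z => ?_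
  simp only [Module.End.mul_apply, opK_tmul]
  rw [negWt_inv, ← mul_assoc, (CartanAlg.isCartan_gen k n).inv, one_mul]
  rfl

theorem opK_opDer (p q : Fin (n - 1) ⊕ Fin (n - 1)) :
    opK v t p 1 * opDer v t q * opK v t p (-1) = (weight v t p (node q) : k) • opDer v t q := by
  refine TensorProduct.ext_threefold fun x y z => ?_
  simp only [Module.End.mul_apply, opK_tmul, opDer_tmul, LinearMap.smul_apply, negDer_negWt,
    map_smul, negWt_inv, (CartanAlg.isCartan_gen k n).conj, TensorProduct.smul_tmul']
  simp

theorem opK_opShift (p : Fin (n - 1) ⊕ Fin (n - 1)) (j : Fin (n - 1)) :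
    opK v t p 1 * opShift v t j * opK v t p (-1) = (weight v t p j : k) • opShift v t j := by
  refine TensorProduct.ext_threefold fun x y z => ?_
  simp only [Module.End.mul_apply, opK_tmul, opShift_tmul, LinearMap.smul_apply, negWt_inv,
    map_mul, CartanAlg.shift_gen, map_smul, smul_mul_assoc,
    (CartanAlg.isCartan_gen k n).mul_mul_cancel, TensorProduct.tmul_smul, TensorProduct.smul_tmul']
  simp

theorem opK_opE (p : Fin (n - 1) ⊕ Fin (n - 1)) (j : Fin (n - 1)) :
    opK v t p 1 * opE v t j * opK v t p (-1) = (weight v t p j : k) • opE v t j := by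
  have h₁ := opK_opDer (v := v) (t := t) p (.inl j)
  have h₂ := opK_opDer (v := v) (t := t) p (.inr j)
  have h₃ := opK_opShift (v := v) (t := t) p j
  simp only [node, Sum.elim_inl, Sum.elim_inr, id] at h₁ h₂
  exact conj_add_smul_sub (A := Module.End k (Model n v t)) h₃ h₁ h₂

theorem opK_opF (p : Fin (n - 1) ⊕ Fin (n - 1)) (j : Fin (n - 1)) :
    opK v t p 1 * opF v t j * opK v t p (-1) = ((weight v t p j)⁻¹ : kˣ).1 • opF v t j := by
  refine TensorProduct.ext_threefold fun x y z => ?_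
  simp only [Module.End.mul_apply, opK_tmul, opF_tmul, LinearMap.smul_apply, negWt_inv,
    map_mul, negWt_gen, smul_mul_assoc, (CartanAlg.isCartan_gen k n).mul_mul_cancel,
    TensorProduct.smul_tmul']
  simp

theorem opDer_opF (p : Fin (n - 1) ⊕ Fin (n - 1)) (j : Fin (n - 1)) :
    opDer v t p * opF v t j = opF v t j * opDer v t p + if node p = j then opK v t p 1 else 0 := by
  refine TensorProduct.ext_threefold fun x y z => ?_
  by_cases hj : node p = j <;>
  simp [opF_tmul, opDer_tmul, opK_tmul, negDer_gen_mul, hj, TensorProduct.add_tmul]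

theorem opShift_opF (i j : Fin (n - 1)) :
    opShift v t i * opF v t j = opF v t j * opShift v t i := by
  refine TensorProduct.ext_threefold fun x y z => ?_
  simp [opF_tmul, opShift_tmul]

theorem opE_opF (i j : Fin (n - 1)) :
    opE v t i * opF v t j = opF v t j * opE v t i +
      if i = j then ((v : k) - (v : k)⁻¹)⁻¹ • (opK v t (.inl i) 1 - opK v t (.inr i) 1)
      else 0 := by
  have h₁ := opDer_opF (v := v) (t := t) (.inl i) j
  have h₂ := opDer_opF (v := v) (t := t) (.inr i) j
  simp only [node, Sum.elim_inl, Sum.elim_inr, id] at h₁ h₂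
  exact commutator_add_smul_sub (A := Module.End k (Model n v t)) (opShift_opF i j) h₁ h₂

/-- Left multiplication on the first factor of the model. -/
noncomputable def negHom (v t : kˣ) :
    SerreAlg n (v : k) ((t⁻¹ : kˣ) : k) →ₐ[k] Module.End k (Model n v t) :=
  AlgHom.ofLinearMap
    (LinearMap.rTensorHom _ ∘ₗ LinearMap.rTensorHom _ ∘ₗ (LinearMap.mul k _)) (by
      refine TensorProduct.ext_threefold fun x y z => ?_
      simp) (by
      intro a b
      refine TensorProduct.ext_threefold fun x y z => ?_
      simp [mul_assoc])

theorem negHom_tmul (a : SerreAlg n (v : k) ((t⁻¹ : kˣ) : k)) :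
    negHom v t a ((x ⊗ₜ y) ⊗ₜ z) = ((a * x) ⊗ₜ y) ⊗ₜ z := rfl

theorem negHom_gen (j : Fin (n - 1)) : negHom v t (SerreAlg.gen _ _ j) = opF v t j := rfl

theorem isPreQuantum_op :
    IsPreQuantum (k := k) v t (opE (n := n) v t) (opF v t) (opK v t) where
  cartan := ⟨fun p ε q δ => opK_comm p q ε δ, opK_inv⟩
  conj_E := opK_opE
  conj_F := opK_opF
  comm_EF := opE_opF
  serre_F := show IsSerre _ _ fun j => negHom v t (SerreAlg.gen _ _ j) from
    (SerreAlg.isSerre_gen (v : k) ((t⁻¹ : kˣ) : k)).map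
      (B := Module.End k (Model n v t)) (negHom v t)

theorem eq_zero_of_commute_opF {S : Module.End k (Model n v t)}
    (hS : ∀ j, Commute S (opF v t j)) (h1 : ∀ y z, S ((1 ⊗ₜ y) ⊗ₜ z) = 0) : S = 0 := by
  refine TensorProduct.ext_threefold fun x y z => ?_
  refine SerreAlg.linearMap_ext
    (f := S ∘ₗ (TensorProduct.mk k _ _).flip z ∘ₗ (TensorProduct.mk k _ _).flip y)
    (g := 0) (h1 y z) ?_ x
  intro j a ha
  change S ((a ⊗ₜ y) ⊗ₜ z) = 0 at ha
  change S (opF v t j ((a ⊗ₜ y) ⊗ₜ z)) = 0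
  rw [← Module.End.mul_apply, (hS j).eq, Module.End.mul_apply, ha, map_zero]

theorem isSerre_opE : IsSerre (v : k) (t : k) (opE (n := n) v t) where
  comm i j h := by
    refine eq_zero_of_commute_opF (isPreQuantum_op.comm_commute h) fun y z => ?_
    have := (SerreAlg.isSerre_gen (v : k) (t : k)).comm i j h
    rw [LinearMap.sub_apply]
    simp only [Module.End.mul_apply, opE_one_tmul, CartanAlg.shift_comm v t j i]
    rw [← TensorProduct.tmul_sub, ← mul_assoc, ← mul_assoc, ← sub_mul, this, zero_mul,
      TensorProduct.tmul_zero]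
  serre₁ i j h := by
    refine eq_zero_of_commute_opF (isPreQuantum_op.serre₁_commute h) fun y z => ?_
    have := congrArg (· * z) ((SerreAlg.isSerre_gen (v : k) (t : k)).serre₁ i j h)
    simp only [pow_two (SerreAlg.gen _ _ _), sub_mul, add_mul, smul_mul_assoc, mul_assoc,
      zero_mul] at this
    simp only [LinearMap.sub_apply, LinearMap.add_apply, LinearMap.smul_apply, pow_two (opE v t _),
      Module.End.mul_apply, opE_one_tmul, CartanAlg.shift_comm v t j i]
    rw [← TensorProduct.tmul_smul, ← TensorProduct.tmul_smul, ← TensorProduct.tmul_sub,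
      ← TensorProduct.tmul_add]
    rw [this, TensorProduct.tmul_zero]
  serre₂ i j h := by
    refine eq_zero_of_commute_opF (isPreQuantum_op.serre₂_commute h) fun y z => ?_
    have := congrArg (· * z) ((SerreAlg.isSerre_gen (v : k) (t : k)).serre₂ i j h)
    simp only [pow_two (SerreAlg.gen _ _ _), sub_mul, add_mul, smul_mul_assoc, mul_assoc,
      zero_mul] at this
    simp only [LinearMap.sub_apply, LinearMap.add_apply, LinearMap.smul_apply, pow_two (opE v t _),
      Module.End.mul_apply, opE_one_tmul, CartanAlg.shift_comm v t j i]
    rw [← TensorProduct.tmul_smul, ← TensorProduct.tmul_smul, ← TensorProduct.tmul_sub,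
      ← TensorProduct.tmul_add]
    rw [this, TensorProduct.tmul_zero]

/-- The action of the quantum algebra on the model. -/
noncomputable def modelRep (n : ℕ) (v t : kˣ) :
    U k n (v : k) (t : k) →ₐ[k] Module.End k (Model n v t) :=
  quantumLift isPreQuantum_op isSerre_opE

theorem modelRep_uE (i : Fin (n - 1)) : modelRep n v t (uE v t i) = opE v t i :=
  quantumLift_gen _ _ _

theorem modelRep_uF (i : Fin (n - 1)) : modelRep n v t (uF v t i) = opF v t i :=
  quantumLift_gen _ _ _

theorem modelRep_uK (p : Fin (n - 1) ⊕ Fin (n - 1)) (ε : ℤˣ) :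
    modelRep n v t (uK v t p ε) = opK v t p ε := by
  cases p <;> exact quantumLift_gen _ _ _

end Model

section Triangular

variable {k : Type} [Field k] {n : ℕ} (v t : kˣ)

variable (n) in
/-- The homomorphism from `N⁻` to the quantum algebra. -/
noncomputable def negIncl :
    SerreAlg n (v : k) ((t⁻¹ : kˣ) : k) →ₐ[k] U k n (v : k) (t : k) :=
  SerreAlg.lift (uF v t) (isPreQuantum_gen v t).serre_F

variable (n) in
/-- The homomorphism from the Cartan algebra to the quantum algebra. -/
noncomputable def zeroIncl : CartanAlg k n →ₐ[k] U k n (v : k) (t : k) :=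
  CartanAlg.lift (uK v t) (isPreQuantum_gen v t).cartan

variable (n) in
/-- The homomorphism from `N⁺` to the quantum algebra. -/
noncomputable def posIncl : SerreAlg n (v : k) (t : k) →ₐ[k] U k n (v : k) (t : k) :=
  SerreAlg.lift (uE v t) (isSerre_uE v t)

theorem negIncl_gen (j : Fin (n - 1)) : negIncl n v t (SerreAlg.gen _ _ j) = uF v t j :=
  SerreAlg.lift_gen _ _ _

theorem zeroIncl_gen (p : Fin (n - 1) ⊕ Fin (n - 1)) (ε : ℤˣ) :
    zeroIncl n v t (CartanAlg.gen k p ε) = uK v t p ε :=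
  CartanAlg.lift_gen _ _ _ _

theorem posIncl_gen (j : Fin (n - 1)) : posIncl n v t (SerreAlg.gen _ _ j) = uE v t j :=
  SerreAlg.lift_gen _ _ _

theorem negIncl_range : (negIncl n v t).range = Uneg k n (v : k) (t : k) :=
  SerreAlg.lift_range _ _

theorem posIncl_range : (posIncl n v t).range = Upos k n (v : k) (t : k) :=
  SerreAlg.lift_range _ _

theorem zeroIncl_range : (zeroIncl n v t).range = Uzero k n (v : k) (t : k) := by
  rw [zeroIncl, CartanAlg.lift_range, Uzero]
  congr 1
  ext u
  constructor
  · rintro ⟨⟨i | i, ε⟩, rfl⟩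
    · exact Or.inl ⟨(i, ε), rfl⟩
    · exact Or.inr ⟨(i, ε), rfl⟩
  · rintro (⟨⟨i, ε⟩, rfl⟩ | ⟨⟨i, ε⟩, rfl⟩)
    · exact ⟨(.inl i, ε), rfl⟩
    · exact ⟨(.inr i, ε), rfl⟩

/-- In the quantum algebra, `K_p^ε x = D(x) K_p^ε` for `x` in `N⁻`. -/
theorem uK_mul_negIncl (p : Fin (n - 1) ⊕ Fin (n - 1)) (ε : ℤˣ)
    (x : SerreAlg n (v : k) ((t⁻¹ : kˣ) : k)) :
    uK v t p ε * negIncl n v t x = negIncl n v t (negWt v t p ε x) * uK v t p ε := by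
  refine SerreAlg.linearMap_ext
    (f := LinearMap.mulLeft k (uK v t p ε) ∘ₗ (negIncl n v t).toLinearMap)
    (g := LinearMap.mulRight k (uK v t p ε) ∘ₗ (negIncl n v t).toLinearMap ∘ₗ
      (negWt v t p ε).toLinearMap) (by simp) ?_ x
  intro j a ha
  simp only [LinearMap.comp_apply, AlgHom.toLinearMap_apply, LinearMap.mulLeft_apply,
    LinearMap.mulRight_apply] at ha ⊢
  rw [map_mul, negIncl_gen, ← mul_assoc, (isPreQuantum_gen v t).κ_mul_F, map_mul, negWt_gen,
    smul_mul_assoc, smul_mul_assoc, map_smul, smul_mul_assoc, map_mul, negIncl_gen, mul_assoc, ha,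
    mul_assoc]

theorem mul_mul_of_commutators {A : Type*} [Ring A] [Algebra k A]
    {e f a r r' d d' K K' : A} {c : k} {P : Prop} [Decidable P]
    (hf : e * f = f * e + if P then c • (K - K') else 0)
    (ha : e * a = a * e + c • (r * K - r' * K')) (hK : K * a = d * K) (hK' : K' * a = d' * K') :
    e * (f * a) = f * a * e + c • ((f * r + if P then d else 0) * K -
      (f * r' + if P then d' else 0) * K') := by
  rw [← mul_assoc, hf, add_mul, mul_assoc, ha]
  split_ifs
  · simp only [smul_mul_assoc, sub_mul, hK, hK', mul_add, add_mul, mul_smul_comm, mul_sub, mul_assoc]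
    module
  · simp only [zero_mul, add_zero, mul_add, mul_smul_comm, mul_sub, mul_assoc]

theorem mul_mul_mul_of_commutators {A : Type*} [Ring A] [Algebra k A]
    {e x y z r r' y' K K' : A} {c : k} (hx : e * x = x * e + c • (r * K - r' * K'))
    (hy : e * y = y' * e) :
    x * y' * (e * z) + c • (r * (K * y) * z - r' * (K' * y) * z) = e * (x * y * z) := by
  rw [← mul_assoc e, ← mul_assoc e, hx, add_mul, mul_assoc x e y, hy]
  simp only [add_mul, sub_mul, smul_mul_assoc, mul_assoc]

/-- The commutator of `E_i` with an element of `N⁻`. -/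
theorem uE_mul_negIncl (i : Fin (n - 1)) (x : SerreAlg n (v : k) ((t⁻¹ : kˣ) : k)) :
    uE v t i * negIncl n v t x = negIncl n v t x * uE v t i + ((v : k) - (v : k)⁻¹)⁻¹ •
      (negIncl n v t (negDer v t (.inl i) x) * uK v t (.inl i) 1 -
        negIncl n v t (negDer v t (.inr i) x) * uK v t (.inr i) 1) := by
  refine SerreAlg.linearMap_ext
    (f := LinearMap.mulLeft k (uE v t i) ∘ₗ (negIncl n v t).toLinearMap)
    (g := LinearMap.mulRight k (uE v t i) ∘ₗ (negIncl n v t).toLinearMap +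
      ((v : k) - (v : k)⁻¹)⁻¹ •
      (LinearMap.mulRight k (uK v t (.inl i) 1) ∘ₗ (negIncl n v t).toLinearMap ∘ₗ
        negDer v t (.inl i) -
      LinearMap.mulRight k (uK v t (.inr i) 1) ∘ₗ (negIncl n v t).toLinearMap ∘ₗ
        negDer v t (.inr i))) (by simp [negDer_one]) ?_ x
  intro j a ha
  simp only [LinearMap.comp_apply, AlgHom.toLinearMap_apply, LinearMap.mulLeft_apply,
    LinearMap.mulRight_apply, LinearMap.add_apply, LinearMap.sub_apply,
    LinearMap.smul_apply] at ha ⊢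
  have hl := uK_mul_negIncl v t (.inl i) 1 a
  have hr := uK_mul_negIncl v t (.inr i) 1 a
  rw [negDer_gen_mul, negDer_gen_mul, map_mul, map_add, map_add, map_mul, map_mul, negIncl_gen,
    apply_ite (negIncl n v t), apply_ite (negIncl n v t), map_zero]
  exact mul_mul_of_commutators ((isPreQuantum_gen v t).comm_EF i j) ha hl hr

theorem uE_mul_zeroIncl (i : Fin (n - 1)) (y : CartanAlg k n) :
    uE v t i * zeroIncl n v t y = zeroIncl n v t (CartanAlg.shift v t i y) * uE v t i := by
  refine CartanAlg.linearMap_ext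
    (f := LinearMap.mulLeft k (uE v t i) ∘ₗ (zeroIncl n v t).toLinearMap)
    (g := LinearMap.mulRight k (uE v t i) ∘ₗ (zeroIncl n v t).toLinearMap ∘ₗ
      (CartanAlg.shift v t i).toLinearMap) (by simp) ?_ y
  intro p ε a ha
  simp only [LinearMap.comp_apply, AlgHom.toLinearMap_apply, LinearMap.mulLeft_apply,
    LinearMap.mulRight_apply] at ha ⊢
  rw [map_mul, map_mul, map_mul, CartanAlg.shift_gen, map_smul, zeroIncl_gen, smul_mul_assoc,
    smul_mul_assoc, mul_assoc, ← ha, ← mul_assoc, ← mul_assoc, (isPreQuantum_gen v t).κ_mul_E,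
    smul_mul_assoc, smul_smul, ← Units.val_mul, ← mul_zpow]
  simp

variable (n) in
/-- Multiplication `x ⊗ y ⊗ z ↦ x y z` from the model to the quantum algebra. -/
noncomputable def modelMul : Model n v t →ₗ[k] U k n (v : k) (t : k) :=
  LinearMap.mul' k _ ∘ₗ TensorProduct.map (LinearMap.mul' k _ ∘ₗ
    TensorProduct.map (negIncl n v t).toLinearMap (zeroIncl n v t).toLinearMap)
    (posIncl n v t).toLinearMap

theorem modelMul_tmul (x : SerreAlg n (v : k) ((t⁻¹ : kˣ) : k)) (y : CartanAlg k n)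
    (z : SerreAlg n (v : k) (t : k)) :
    modelMul n v t ((x ⊗ₜ y) ⊗ₜ z) = negIncl n v t x * zeroIncl n v t y * posIncl n v t z := by
  simp [modelMul]

theorem modelMul_opF (j : Fin (n - 1)) (m : Model n v t) :
    modelMul n v t (opF v t j m) = uF v t j * modelMul n v t m := by
  revert m
  refine LinearMap.congr_fun (f := modelMul n v t ∘ₗ opF v t j)
    (g := LinearMap.mulLeft k (uF v t j) ∘ₗ modelMul n v t) ?_
  refine TensorProduct.ext_threefold fun x y z => ?_
  simp only [LinearMap.comp_apply, LinearMap.mulLeft_apply, opF_tmul, modelMul_tmul, map_mul,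
    negIncl_gen, mul_assoc]

theorem modelMul_opK (p : Fin (n - 1) ⊕ Fin (n - 1)) (ε : ℤˣ) (m : Model n v t) :
    modelMul n v t (opK v t p ε m) = uK v t p ε * modelMul n v t m := by
  revert m
  refine LinearMap.congr_fun (f := modelMul n v t ∘ₗ opK v t p ε)
    (g := LinearMap.mulLeft k (uK v t p ε) ∘ₗ modelMul n v t) ?_
  refine TensorProduct.ext_threefold fun x y z => ?_
  simp only [LinearMap.comp_apply, LinearMap.mulLeft_apply, opK_tmul, modelMul_tmul, map_mul,
    zeroIncl_gen]
  simp only [← mul_assoc, uK_mul_negIncl]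

theorem modelMul_opE (i : Fin (n - 1)) (m : Model n v t) :
    modelMul n v t (opE v t i m) = uE v t i * modelMul n v t m := by
  revert m
  refine LinearMap.congr_fun (f := modelMul n v t ∘ₗ opE v t i)
    (g := LinearMap.mulLeft k (uE v t i) ∘ₗ modelMul n v t) ?_
  refine TensorProduct.ext_threefold fun x y z => ?_
  simp only [LinearMap.comp_apply, LinearMap.mulLeft_apply, opE, LinearMap.add_apply,
    LinearMap.smul_apply, LinearMap.sub_apply, map_add, map_sub, map_smul, opShift_tmul,
    opDer_tmul, modelMul_tmul, map_mul, zeroIncl_gen, posIncl_gen]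
  exact mul_mul_mul_of_commutators (uE_mul_negIncl v t i x) (uE_mul_zeroIncl v t i y)

theorem modelMul_modelRep (u : U k n (v : k) (t : k)) (m : Model n v t) :
    modelMul n v t (modelRep n v t u m) = u * modelMul n v t m := by
  revert m
  refine presented_induction (Rel k n (v : k) (t : k))
    { carrier := {u | ∀ m, modelMul n v t (modelRep n v t u m) = u * modelMul n v t m}
      add_mem' := fun {a b} ha hb m => by
        rw [map_add, LinearMap.add_apply, map_add, ha m, hb m, add_mul]
      zero_mem' := fun m => by rw [map_zero, LinearMap.zero_apply, map_zero, zero_mul]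
      smul_mem' := fun c a ha m => by
        rw [map_smul, LinearMap.smul_apply, map_smul, ha m, smul_mul_assoc] } ?_ ?_ u
  · intro m
    rw [map_one, Module.End.one_apply, one_mul]
  · intro g a ha m
    change modelMul n v t (modelRep n v t (gen k n v t g * a) m) = _
    rw [map_mul, Module.End.mul_apply, mul_assoc, ← ha m]
    rcases g with i | i | ⟨i, ε⟩ | ⟨i, ε⟩
    · exact (congrArg (fun f : Module.End k (Model n v t) => modelMul n v t (f _))
        (modelRep_uE i)).trans (modelMul_opE v t i _)
    · exact (congrArg (fun f : Module.End k (Model n v t) => modelMul n v t (f _))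
        (modelRep_uF i)).trans (modelMul_opF v t i _)
    · exact (congrArg (fun f : Module.End k (Model n v t) => modelMul n v t (f _))
        (modelRep_uK (.inl i) ε)).trans (modelMul_opK v t (.inl i) ε _)
    · exact (congrArg (fun f : Module.End k (Model n v t) => modelMul n v t (f _))
        (modelRep_uK (.inr i) ε)).trans (modelMul_opK v t (.inr i) ε _)

theorem modelRep_negIncl (x : SerreAlg n (v : k) ((t⁻¹ : kˣ) : k)) :
    modelRep n v t (negIncl n v t x) = negHom v t x := by
  have : (modelRep n v t).comp (negIncl n v t) = negHom v t :=
    SerreAlg.algHom_ext (A := Module.End k (Model n v t)) fun i => by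
      rw [AlgHom.comp_apply, negIncl_gen, modelRep_uF, negHom_gen]
  exact DFunLike.congr_fun this x

theorem modelRep_posIncl (z : SerreAlg n (v : k) (t : k)) :
    modelRep n v t (posIncl n v t z) ((1 ⊗ₜ 1) ⊗ₜ 1) = (1 ⊗ₜ 1) ⊗ₜ z := by
  refine SerreAlg.linearMap_ext
    (f := LinearMap.applyₗ ((1 ⊗ₜ 1) ⊗ₜ 1 : Model n v t) ∘ₗ
      (modelRep n v t).toLinearMap ∘ₗ (posIncl n v t).toLinearMap)
    (g := TensorProduct.mk k _ _ (1 ⊗ₜ 1)) ?_ ?_ z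
  · simp
  · intro i a ha
    change modelRep n v t (posIncl n v t a) ((1 ⊗ₜ 1) ⊗ₜ 1) = (1 ⊗ₜ 1) ⊗ₜ a at ha
    change modelRep n v t (posIncl n v t (SerreAlg.gen _ _ i * a)) ((1 ⊗ₜ 1) ⊗ₜ 1) =
      (1 ⊗ₜ 1) ⊗ₜ (SerreAlg.gen _ _ i * a)
    rw [map_mul, map_mul, Module.End.mul_apply, ha, posIncl_gen, modelRep_uE, opE_one_tmul,
      map_one]

theorem modelRep_zeroIncl (y : CartanAlg k n) (z : SerreAlg n (v : k) (t : k)) :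
    modelRep n v t (zeroIncl n v t y) ((1 ⊗ₜ 1) ⊗ₜ z) = (1 ⊗ₜ y) ⊗ₜ z := by
  refine CartanAlg.linearMap_ext
    (f := LinearMap.applyₗ ((1 ⊗ₜ 1) ⊗ₜ z : Model n v t) ∘ₗ
      (modelRep n v t).toLinearMap ∘ₗ (zeroIncl n v t).toLinearMap)
    (g := (TensorProduct.mk k _ _).flip z ∘ₗ TensorProduct.mk k _ _ 1) ?_ ?_ y
  · simp
  · intro p ε a ha
    change modelRep n v t (zeroIncl n v t a) ((1 ⊗ₜ 1) ⊗ₜ z) = (1 ⊗ₜ a) ⊗ₜ z at ha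
    change modelRep n v t (zeroIncl n v t (CartanAlg.gen k p ε * a)) ((1 ⊗ₜ 1) ⊗ₜ z) =
      (1 ⊗ₜ (CartanAlg.gen k p ε * a)) ⊗ₜ z
    rw [map_mul, map_mul, Module.End.mul_apply, ha, zeroIncl_gen, modelRep_uK, opK_tmul, map_one]

theorem modelRep_modelMul (m : Model n v t) :
    modelRep n v t (modelMul n v t m) ((1 ⊗ₜ 1) ⊗ₜ 1) = m := by
  revert m
  refine LinearMap.congr_fun (f := LinearMap.applyₗ ((1 ⊗ₜ 1) ⊗ₜ 1 : Model n v t) ∘ₗ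
    (modelRep n v t).toLinearMap ∘ₗ modelMul n v t) (g := LinearMap.id) ?_
  refine TensorProduct.ext_threefold fun x y z => ?_
  change modelRep n v t (modelMul n v t ((x ⊗ₜ y) ⊗ₜ z)) ((1 ⊗ₜ 1) ⊗ₜ 1) = (x ⊗ₜ y) ⊗ₜ z
  rw [modelMul_tmul, map_mul, map_mul, Module.End.mul_apply, Module.End.mul_apply,
    modelRep_posIncl, modelRep_zeroIncl, modelRep_negIncl, negHom_tmul, mul_one]

theorem modelMul_bijective : Function.Bijective (modelMul n v t) := by
  refine ⟨fun a b h => ?_, fun u => ⟨modelRep n v t u ((1 ⊗ₜ 1) ⊗ₜ 1), ?_⟩⟩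
  · rw [← modelRep_modelMul v t a, h, modelRep_modelMul]
  · rw [modelMul_modelRep, modelMul_tmul]
    simp

/-- Triangular decomposition of the two-parameter quantum algebra over any field, for invertible
parameters. -/
theorem triangular_decomposition :
    ∃ e : ((Uneg k n (v : k) (t : k) ⊗[k] Uzero k n (v : k) (t : k)) ⊗[k]
        Upos k n (v : k) (t : k)) ≃ₗ[k] U k n (v : k) (t : k),
      ∀ (x : Uneg k n (v : k) (t : k)) (y : Uzero k n (v : k) (t : k))
        (z : Upos k n (v : k) (t : k)),
        e ((x ⊗ₜ y) ⊗ₜ z) = (x : U k n (v : k) (t : k)) * y * z := by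
  let μ : ((Uneg k n (v : k) (t : k) ⊗[k] Uzero k n (v : k) (t : k)) ⊗[k]
      Upos k n (v : k) (t : k)) →ₗ[k] U k n (v : k) (t : k) :=
    LinearMap.mul' k _ ∘ₗ TensorProduct.map (LinearMap.mul' k _ ∘ₗ
      TensorProduct.map (Uneg k n (v : k) (t : k)).val.toLinearMap
        (Uzero k n (v : k) (t : k)).val.toLinearMap) (Upos k n (v : k) (t : k)).val.toLinearMap
  have hμ : ∀ x y z, μ ((x ⊗ₜ y) ⊗ₜ z) = (x : U k n (v : k) (t : k)) * y * z :=
    fun x y z => by simp [μ]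
  let ι₁ := (negIncl n v t).codRestrict (Uneg k n (v : k) (t : k))
    fun x => negIncl_range (n := n) v t ▸ ⟨x, rfl⟩
  let ι₂ := (zeroIncl n v t).codRestrict (Uzero k n (v : k) (t : k))
    fun x => zeroIncl_range (n := n) v t ▸ ⟨x, rfl⟩
  let ι₃ := (posIncl n v t).codRestrict (Upos k n (v : k) (t : k))
    fun x => posIncl_range (n := n) v t ▸ ⟨x, rfl⟩
  have h₁ : Function.Surjective ι₁.toLinearMap := by
    rintro ⟨u, hu⟩
    rw [← negIncl_range] at hu
    obtain ⟨x, hx⟩ := hu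
    exact ⟨x, Subtype.ext hx⟩
  have h₂ : Function.Surjective ι₂.toLinearMap := by
    rintro ⟨u, hu⟩
    rw [← zeroIncl_range] at hu
    obtain ⟨x, hx⟩ := hu
    exact ⟨x, Subtype.ext hx⟩
  have h₃ : Function.Surjective ι₃.toLinearMap := by
    rintro ⟨u, hu⟩
    rw [← posIncl_range] at hu
    obtain ⟨x, hx⟩ := hu
    exact ⟨x, Subtype.ext hx⟩
  let s := TensorProduct.map (TensorProduct.map ι₁.toLinearMap ι₂.toLinearMap) ι₃.toLinearMap
  have hs : Function.Surjective s := TensorProduct.map_surjective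
    (TensorProduct.map_surjective h₁ h₂) h₃
  have hμs : ∀ m, μ (s m) = modelMul n v t m := by
    refine LinearMap.congr_fun (f := μ ∘ₗ s) ?_
    refine TensorProduct.ext_threefold fun x y z => ?_
    rw [modelMul_tmul]
    exact hμ _ _ _
  obtain ⟨hinj, hsurj⟩ := modelMul_bijective (n := n) v t
  refine ⟨LinearEquiv.ofBijective μ ⟨?_, ?_⟩, hμ⟩
  · intro a b hab
    obtain ⟨a, rfl⟩ := hs a
    obtain ⟨b, rfl⟩ := hs b
    rw [hμs, hμs] at hab
    rw [hinj hab]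
  · intro u
    obtain ⟨m, rfl⟩ := hsurj u
    exact ⟨s m, hμs m⟩

theorem vv_ne_zero : vv ≠ 0 := by
  rw [vv, Ne, FaithfulSMul.algebraMap_eq_zero_iff]
  exact MvPolynomial.X_ne_zero 0

theorem tt_ne_zero : tt ≠ 0 := by
  rw [tt, Ne, FaithfulSMul.algebraMap_eq_zero_iff]
  exact MvPolynomial.X_ne_zero 1

end Triangular

end TwoParamQuantum

open TwoParamQuantum in
/-- Triangular decomposition: multiplication `x ⊗ y ⊗ z ↦ x y z` is an isomorphism of
`ℚ(v, t)`-vector spaces `U⁻ ⊗ U⁰ ⊗ U⁺ ≅ U_{v,t}(sl_n)`. -/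
theorem mainTheorem9 (n : ℕ) :
    ∃ e : ((UvtNeg n ⊗[Qvt] UvtZero n) ⊗[Qvt] UvtPos n) ≃ₗ[Qvt] Uvt n,
      ∀ (x : UvtNeg n) (y : UvtZero n) (z : UvtPos n),
        e ((x ⊗ₜ y) ⊗ₜ z) = (x : Uvt n) * (y : Uvt n) * (z : Uvt n) := by
  exact triangular_decomposition (n := n) (Units.mk0 vv vv_ne_zero) (Units.mk0 tt tt_ne_zero)
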